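/- Let $n\ge 0$. For an open $U\subseteq\mathbb R^n$ put $T_0U=\{(x,y):x\in U,\ y\in\mathbb R^n\setminus\{0\}\}$. A Finsler metric on $U$ is a continuous $F:U\times\mathbb R^n\to\mathbb R$, smooth and positive on $T_0U$, positively $1$-homogeneous in $y$, with $\tfrac12\,\partial^2F^2/\partial y^i\partial y^j$ nondegenerate on $T_0U$. A spray is $S=y^i\partial_{x^i}-2G^i(x,y)\partial_{y^i}$ with $G^i$ smooth on $T_0U$ and positively $2$-homogeneous in $y$; put $N^i_j=\partial G^i/\partial y^j$, $\tfrac{\delta}{\delta x^j}=\partial_{x^j}-N^k_j\partial_{y^k}$, $\mathcal C=y^i\partial_{y^i}$, and for a function $L$ on $T_0U$ $$\delta_SL=\Big(S\big(\tfrac{\partial L}{\partial y^i}\big)-\tfrac{\partial L}{\partial x^i}\Big)dx^i,\qquad d_JL=\tfrac{\partial L}{\partial y^i}dx^i,\qquad d_hL=\tfrac{\delta L}{\delta x^i}dx^i .$$ The geodesic spray of $F$ is the spray with $\delta_SF^2=0$; geodesics are the regular solutions in $U$ of $\ddot x^i+2G^i(x,\dot x)=0$. $F$ is projectively flat if its geodesics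 are, as point sets, pieces of straight lines. Finsler metrics $F,\overline F$ with geodesic sprays $S,\overline S$ are projectively related, with projective factor $P$, if $\overline S=S-2P\mathcal C$ for some $P$ smooth on $T_0U$ and positively $1$-homogeneous in $y$; such a $P$ is a Hamel function of $S$ if $\delta_SP=0$. $F$ has constant flag curvature $\kappa$ if the Jacobi endomorphism $R^i_j=2\tfrac{\delta G^i}{\delta x^j}-S(N^i_j)+N^i_kN^k_j$ of its geodesic spray equals $\kappa F^2\delta^i_j-\kappa F\tfrac{\partial F}{\partial y^j}y^i$ on $T_0U$. The flat spray is $S_0=y^i\partial_{x^i}$. (1) Let $U\subseteq\mathbb R^n$ be open, $g$ a smooth Riemannian metric on $U$, $a=\sqrt{g_{ij}(x)y^iy^j}$, $b=b_i(x)y^i$ with $b_i\,dx^i$ a smooth closed $1$-form, and suppose that $F=a+b$ is a Finsler metric on $U$ (a Randers metric), with geodesic spray $S$. Let $f$ be a smooth positive function on $U$. Then $\overline F=f(x)\,\dfrac{F^2}{a}$ is a Finsler metric projectively related to $F$ if and only if, on $T_0U$, $$\frac{F^2}{a}\,d_hf-S(f)\,d_J\Big(\frac{F^2}{a}\Big)+f\,S(a)\,d_J\Big(\frac{F^2}{a^2}\Big)=0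 .$$ (2) Let $c\in\mathbb R$, $\eta>0$, $U_c=\{x\in\mathbb R^n:4c^2|x|^2<1\}$, and $$a=\frac{\sqrt{|y|^2-4c^2(|x|^2|y|^2-\langle x,y\rangle^2)}}{1-4c^2|x|^2},\quad b=\frac{2c\langle x,y\rangle}{1-4c^2|x|^2},\quad F=a+b,\quad \overline F=\frac{\eta}{1-4c^2|x|^2}\cdot\frac{F^2}{a}$$ on $U_c$ (with $\overline F(x,0)=0$), that is, $$\overline F=\frac{\eta\left(\sqrt{|y|^2-4c^2(|x|^2|y|^2-\langle x,y\rangle^2)}+2c\langle x,y\rangle\right)^2}{(1-4c^2|x|^2)^2\sqrt{|y|^2-4c^2(|x|^2|y|^2-\langle x,y\rangle^2)}} .$$ Then $F$ and $\overline F$ are projectively flat Finsler metrics on $U_c$, with geodesic sprays $S=S_0-2cF\,\mathcal C$ and $\overline S=S_0-4cF\,\mathcal C$. In particular they are projectively related with projective factor $P=cF$, i.e. $\overline S=S-2cF\,\mathcal C$; moreover $P=cF$ is a Hamel function of $S$, and $\overline F$ has constant flag curvature $0$. (3) For $c=\tfrac12$, $\eta=1$, $U_c$ is the unit ball $B^n$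 and $F$, $\overline F$ are the Funk metric and the Berwald metric $$F=\frac{\sqrt{|y|^2-(|x|^2|y|^2-\langle x,y\rangle^2)}+\langle x,y\rangle}{1-|x|^2},\qquad \overline F=\frac{\left(\sqrt{|y|^2-(|x|^2|y|^2-\langle x,y\rangle^2)}+\langle x,y\rangle\right)^2}{(1-|x|^2)^2\sqrt{|y|^2-(|x|^2|y|^2-\langle x,y\rangle^2)}},$$ which are therefore projectively related on $B^n$ with projective factor $\tfrac12F$. -/

import Mathlib

open scoped ContDiff

namespace ProjFinsler

/-- The model space `ℝⁿ` with its Euclidean inner product. -/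
abbrev V (n : ℕ) : Type := EuclideanSpace ℝ (Fin n)

/-- The slit tangent bundle `T₀U = {(x, y) : x ∈ U, y ≠ 0}` of `U ⊆ ℝⁿ`. -/
def slit {n : ℕ} (U : Set (V n)) : Set (V n × V n) := {p | p.1 ∈ U ∧ p.2 ≠ 0}

section Calculus

variable {n : ℕ} {E : Type*} [NormedAddCommGroup E] [NormedSpace ℝ E]

/-- Derivative of `L(x, y)` in the base variable `x`, in the direction `v`: `vⁱ ∂L/∂xⁱ`. -/
noncomputable def dBase (L : V n → V n → E) (x y v : V n) : E :=
  fderiv ℝ (fun x' => L x' y) x v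

/-- Derivative of `L(x, y)` in the fibre variable `y`, in the direction `v`: `vⁱ ∂L/∂yⁱ`.
For a scalar `L` this is the value on `v` of the semi-basic 1-form `d_J L`. -/
noncomputable def dFib (L : V n → V n → E) (x y v : V n) : E :=
  fderiv ℝ (fun y' => L x y') y v

/-- The derivation `S = yⁱ ∂/∂xⁱ - 2 Gⁱ(x, y) ∂/∂yⁱ` with coefficients `G`, applied to `L`. -/
noncomputable def sprayDeriv (G : V n → V n → V n) (L : V n → V n → E) (x y : V n) : E :=
  dBase L x y y - (2 : ℝ) • dFib L x y (G x y)

/-- The nonlinear connection `N(x, y) v = vⁱ ∂G/∂yⁱ`. -/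
noncomputable def conn (G : V n → V n → V n) (x y v : V n) : V n := dFib G x y v

/-- The horizontal derivative `d_h L (v) = vⁱ δL/δxⁱ`, where
`δ/δxⁱ = ∂/∂xⁱ - Nᵢʲ ∂/∂yʲ`. -/
noncomputable def horizDeriv (G : V n → V n → V n) (L : V n → V n → E) (x y v : V n) : E :=
  dBase L x y v - dFib L x y (conn G x y v)

/-- The Jacobi endomorphism
`Rⁱⱼ = 2 δGⁱ/δxʲ - S(Nⁱⱼ) + Nⁱₖ Nᵏⱼ` applied to the vector `v`. -/
noncomputable def jacobi (G : V n → V n → V n) (x y v : V n) : V n :=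
  (2 : ℝ) • horizDeriv G G x y v - sprayDeriv G (fun x' y' => conn G x' y' v) x y
    + conn G x y (conn G x y v)

/-- The Euler-Lagrange 1-form `δ_S L = (S(∂L/∂yⁱ) - ∂L/∂xⁱ) dxⁱ`, evaluated on `v`. -/
noncomputable def eulerLagrange (G : V n → V n → V n) (L : V n → V n → ℝ) (x y v : V n) : ℝ :=
  sprayDeriv G (fun x' y' => dFib L x' y' v) x y - dBase L x y v

/-- The metric tensor `g(v, w) = (1/2) ∂²F²/∂yⁱ∂yʲ vⁱ wʲ`. -/
noncomputable def metricTensor (F : V n → V n → ℝ) (x y v w : V n) : ℝ :=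
  (1 / 2) * dFib (fun x' y' => dFib (fun x'' y'' => F x'' y'' ^ 2) x' y' v) x y w

end Calculus

section Metrics

variable {n : ℕ}

/-- `F` is a Finsler function on the tangent bundle of `U`. -/
structure IsFinsler (U : Set (V n)) (F : V n → V n → ℝ) : Prop where
  continuousOn : ContinuousOn (fun p : V n × V n => F p.1 p.2) (U ×ˢ Set.univ)
  smooth : ContDiffOn ℝ ∞ (fun p : V n × V n => F p.1 p.2) (slit U)
  pos : ∀ x ∈ U, ∀ y : V n, y ≠ 0 → 0 < F x y
  homog : ∀ x ∈ U, ∀ y : V n, ∀ r : ℝ, 0 < r → F x (r • y) = r * F x y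
  nondegenerate : ∀ x ∈ U, ∀ y : V n, y ≠ 0 → ∀ v : V n,
    (∀ w : V n, metricTensor F x y v w = 0) → v = 0

/-- `G` are the coefficients of a spray on `U`: smooth on `T₀U`, homogeneous of degree two. -/
structure IsSpray (U : Set (V n)) (G : V n → V n → V n) : Prop where
  smooth : ContDiffOn ℝ ∞ (fun p : V n × V n => G p.1 p.2) (slit U)
  homog : ∀ x ∈ U, ∀ y : V n, y ≠ 0 → ∀ r : ℝ, 0 < r → G x (r • y) = r ^ 2 • G x y

/-- `G` are the coefficients of the geodesic spray of `F` on `U`: `δ_S F² = 0` on `T₀U`. For a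
Finsler function `F` these coefficients are unique on `T₀U`. -/
structure IsGeodesicSpray (U : Set (V n)) (F : V n → V n → ℝ) (G : V n → V n → V n) : Prop where
  isSpray : IsSpray U G
  eulerLagrange_sq : ∀ x ∈ U, ∀ y : V n, y ≠ 0 → ∀ v : V n,
    eulerLagrange G (fun x' y' => F x' y' ^ 2) x y v = 0

/-- `γ` is, on the open interval `(s, t)`, a regular curve in `U` that solves
`γ'' + 2 G(γ, γ') = 0`. -/
def IsGeodesic (U : Set (V n)) (G : V n → V n → V n) (γ : ℝ → V n) (s t : ℝ) : Prop :=
  ∀ τ ∈ Set.Ioo s t, γ τ ∈ U ∧ DifferentiableAt ℝ γ τ ∧ deriv γ τ ≠ 0 ∧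
    HasDerivAt (deriv γ) (-((2 : ℝ) • G (γ τ) (deriv γ τ))) τ

/-- `F` is a projectively flat Finsler metric on `U`: as point sets, its geodesics are
(pieces of) straight lines. -/
def IsProjectivelyFlat (U : Set (V n)) (F : V n → V n → ℝ) : Prop :=
  IsFinsler U F ∧ ∃ G : V n → V n → V n, IsGeodesicSpray U F G ∧
    ∀ (γ : ℝ → V n) (s t : ℝ), IsGeodesic U G γ s t → Collinear ℝ (γ '' Set.Ioo s t)

/-- A smooth function on `T₀U` that is positively homogeneous of degree one. -/
structure IsOneHomogeneous (U : Set (V n)) (P : V n → V n → ℝ) : Prop where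
  smooth : ContDiffOn ℝ ∞ (fun p : V n × V n => P p.1 p.2) (slit U)
  homog : ∀ x ∈ U, ∀ y : V n, y ≠ 0 → ∀ r : ℝ, 0 < r → P x (r • y) = r * P x y

/-- `F` and `F'` are projectively related Finsler metrics on `U` with projective factor `P`: the
geodesic sprays satisfy `S' = S - 2 P 𝒞`, that is, `G'ⁱ = Gⁱ + P yⁱ`. -/
def IsProjectivelyRelatedBy (U : Set (V n)) (F F' P : V n → V n → ℝ) : Prop :=
  IsFinsler U F ∧ IsFinsler U F' ∧ IsOneHomogeneous U P ∧
    ∃ G G' : V n → V n → V n, IsGeodesicSpray U F G ∧ IsGeodesicSpray U F' G' ∧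
      ∀ x ∈ U, ∀ y : V n, y ≠ 0 → G' x y = G x y + P x y • y

/-- `F` and `F'` are projectively related Finsler metrics on `U`. -/
def IsProjectivelyRelated (U : Set (V n)) (F F' : V n → V n → ℝ) : Prop :=
  ∃ P : V n → V n → ℝ, IsProjectivelyRelatedBy U F F' P

/-- `P` is a Hamel function for the spray with coefficients `G`: it is homogeneous of degree one
and `δ_S P = 0`. -/
def IsHamel (U : Set (V n)) (G : V n → V n → V n) (P : V n → V n → ℝ) : Prop :=
  IsOneHomogeneous U P ∧ ∀ x ∈ U, ∀ y : V n, y ≠ 0 → ∀ v : V n, eulerLagrange G P x y v = 0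

/-- `F` is a Finsler metric of constant flag curvature `κ` on `U`:
`Φ = κ F² J - κ F d_J F ⊗ 𝒞`. -/
def HasConstantFlagCurvature (U : Set (V n)) (F : V n → V n → ℝ) (κ : ℝ) : Prop :=
  IsFinsler U F ∧ ∃ G : V n → V n → V n, IsGeodesicSpray U F G ∧
    ∀ x ∈ U, ∀ y : V n, y ≠ 0 → ∀ v : V n,
      jacobi G x y v = (κ * F x y ^ 2) • v - (κ * F x y * dFib F x y v) • y

/-- `g` is a Riemannian metric on `U`. -/
structure IsRiemannian (U : Set (V n)) (g : V n → V n →L[ℝ] V n →L[ℝ] ℝ) : Prop where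
  smooth : ContDiffOn ℝ ∞ g U
  symm : ∀ x ∈ U, ∀ v w : V n, g x v w = g x w v
  posDef : ∀ x ∈ U, ∀ v : V n, v ≠ 0 → 0 < g x v v

/-- `β` is a closed 1-form on `U`. -/
structure IsClosedForm (U : Set (V n)) (β : V n → V n →L[ℝ] ℝ) : Prop where
  smooth : ContDiffOn ℝ ∞ β U
  closed : ∀ x ∈ U, ∀ v w : V n, fderiv ℝ β x v w = fderiv ℝ β x w v

/-- The norm function `a(x, y) = √(g_{ij}(x) yⁱ yʲ)` of a Riemannian metric. -/
noncomputable def riemNorm (g : V n → V n →L[ℝ] V n →L[ℝ] ℝ) (x y : V n) : ℝ :=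
  Real.sqrt (g x y y)

/-- The function `a + b` with `a = √(g_{ij} yⁱ yʲ)` and `b = βᵢ yⁱ`. -/
noncomputable def randersOf (g : V n → V n →L[ℝ] V n →L[ℝ] ℝ) (β : V n → V n →L[ℝ] ℝ)
    (x y : V n) : ℝ :=
  riemNorm g x y + β x y

/-- The deformation `f(x) F² / a`. -/
noncomputable def deform (f : V n → ℝ) (F a : V n → V n → ℝ) (x y : V n) : ℝ :=
  f x * (F x y ^ 2 / a x y)

/-- The domain `4c²|x|² < 1`. -/
def dom (n : ℕ) (c : ℝ) : Set (V n) := {x | 4 * c ^ 2 * ‖x‖ ^ 2 < 1}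

/-- `√(|y|² - 4c²(|x|²|y|² - ⟨x,y⟩²))`. -/
noncomputable def rad (c : ℝ) (x y : V n) : ℝ :=
  Real.sqrt (‖y‖ ^ 2 - 4 * c ^ 2 * (‖x‖ ^ 2 * ‖y‖ ^ 2 - inner ℝ x y ^ 2))

/-- The Riemannian part `a` of the family of Randers metrics. -/
noncomputable def aPart (c : ℝ) (x y : V n) : ℝ :=
  rad c x y / (1 - 4 * c ^ 2 * ‖x‖ ^ 2)

/-- The linear part `b` of the family of Randers metrics. -/
noncomputable def bPart (c : ℝ) (x y : V n) : ℝ :=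
  2 * c * inner ℝ x y / (1 - 4 * c ^ 2 * ‖x‖ ^ 2)

/-- The family of Randers metrics `F = a + b`. -/
noncomputable def randers (c : ℝ) (x y : V n) : ℝ := aPart c x y + bPart c x y

/-- The family `F̄ = f F² / a` with `f = η / (1 - 4c²|x|²)`. -/
noncomputable def berwaldFamily (c η : ℝ) : V n → V n → ℝ :=
  deform (fun x => η / (1 - 4 * c ^ 2 * ‖x‖ ^ 2)) (randers c) (aPart c)

/-- The Funk metric of the unit ball. -/
noncomputable def funk (x y : V n) : ℝ :=
  Real.sqrt (‖y‖ ^ 2 - (‖x‖ ^ 2 * ‖y‖ ^ 2 - inner ℝ x y ^ 2)) / (1 - ‖x‖ ^ 2)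
    + inner ℝ x y / (1 - ‖x‖ ^ 2)

/-- The Berwald metric of the unit ball. -/
noncomputable def berwald (x y : V n) : ℝ :=
  (Real.sqrt (‖y‖ ^ 2 - (‖x‖ ^ 2 * ‖y‖ ^ 2 - inner ℝ x y ^ 2)) + inner ℝ x y) ^ 2 /
    ((1 - ‖x‖ ^ 2) ^ 2 * Real.sqrt (‖y‖ ^ 2 - (‖x‖ ^ 2 * ‖y‖ ^ 2 - inner ℝ x y ^ 2)))

end Metrics

end ProjFinsler

open ProjFinsler

/-! Two facts about one-homogeneous functions L carry everything. Euler's identity shows that the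
fibre Hessian of L kills y, so δ_S L is unchanged when S is replaced by S − 2P𝒞, while S(L) drops by
2PL. Moreover δ_S L² = 2(L δ_S L + S(L) d_J L), and evaluating at y shows that, where L ≠ 0, δ_S L²
= 0 splits into δ_S L = 0 and S(L) = 0. Together they give Rapcsák's criterion
(`IsFinsler.isProjectivelyRelated_iff`): F' is projectively related to F exactly when δ_S F' = 0,
the factor then being S(F')/(2F').

For part (1), closedness of b gives δ_S b = 0, hence δ_S a = 0; with δ_S F = 0 and S(F) = 0 the
Leibniz rule turns δ_S(fF²/a) into minus the left side of the stated condition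
(`eulerLagrange_deform`). That fF²/a is a Finsler metric at all (`IsRiemannian.deform_isFinsler`)
rests on F < 2a, which follows from positivity of F at both y and −y.

For part (2), the whole family is governed by ∂F/∂xⁱ = 2cF ∂F/∂yⁱ and ∂F̄/∂xⁱ = 2c ∂(FF̄)/∂yⁱ
(`dBase_randers`, `dBase_berwaldFamily`). An equation ∂L/∂xⁱ = ∂(PL)/∂yⁱ for a Finsler metric L
makes Pyⁱ its spray coefficients, so the factors over the flat spray are cF and 2cF. Such sprays
have straight geodesics, and P = 2cF satisfies ∂P/∂xⁱ = P ∂P/∂yⁱ, which annihilates the Jacobi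
endomorphism (`jacobi_smul_self`). Part (3) is the substitution c = 1/2, η = 1. -/

namespace ProjFinsler

open Filter Topology

/-! ### Second derivatives of scalar functions: symmetry and the product rule. -/

section SecondDerivative

variable {X : Type*} [NormedAddCommGroup X] [NormedSpace ℝ X]

/-- The second derivative of a scalar function, differentiated first along `v`, then along `w`. -/
noncomputable def secondDeriv (A : X → ℝ) (p w v : X) : ℝ := fderiv ℝ (fderiv ℝ A) p w v

theorem _root_.ContDiffAt.eventually_differentiableAt {Y : Type*} [NormedAddCommGroup Y]
    [NormedSpace ℝ Y] {A : X → Y} {p : X}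
    (h : ContDiffAt ℝ ∞ A p) : ∀ᶠ q in 𝓝 p, DifferentiableAt ℝ A q := by
  have h1 : ContDiffAt ℝ 1 A p := h.of_le (by exact_mod_cast le_top)
  filter_upwards [h1.eventually (by simp)] with q hq
  exact hq.differentiableAt (by simp)

theorem contDiffAt_fderiv {Y : Type*} [NormedAddCommGroup Y]
    [NormedSpace ℝ Y] {A : X → Y} {p : X} (h : ContDiffAt ℝ ∞ A p) :
    ContDiffAt ℝ ∞ (fderiv ℝ A) p :=
  h.fderiv_right (m := ∞) (by simp)

theorem differentiableAt_fderiv {A : X → ℝ} {p : X} (h : ContDiffAt ℝ ∞ A p) :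
    DifferentiableAt ℝ (fderiv ℝ A) p :=
  (contDiffAt_fderiv h).differentiableAt (by simp)

theorem hasFDerivAt_fderiv_apply {A : X → ℝ} {p : X} (h : ContDiffAt ℝ ∞ A p) (v : X) :
    HasFDerivAt (fun q => fderiv ℝ A q v) ((fderiv ℝ (fderiv ℝ A) p).flip v) p := by
  simpa using (differentiableAt_fderiv h).hasFDerivAt.clm_apply (hasFDerivAt_const v p)

theorem fderiv_fderiv_apply {A : X → ℝ} {p : X} (h : ContDiffAt ℝ ∞ A p) (v w : X) :
    fderiv ℝ (fun q => fderiv ℝ A q v) p w = secondDeriv A p w v := by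
  rw [(hasFDerivAt_fderiv_apply h v).fderiv]; rfl

theorem secondDeriv_symm {A : X → ℝ} {p : X} (h : ContDiffAt ℝ ∞ A p) (v w : X) :
    secondDeriv A p w v = secondDeriv A p v w :=
  (h.isSymmSndFDerivAt (by simpa using (WithTop.coe_le_coe.2 le_top : ((2 : ℕ∞) : WithTop ℕ∞) ≤ ∞))) w v

theorem secondDeriv_congr {A B : X → ℝ} {p : X} (h : A =ᶠ[𝓝 p] B) (v w : X) :
    secondDeriv A p w v = secondDeriv B p w v := by
  unfold secondDeriv; rw [h.fderiv.fderiv_eq]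

theorem secondDeriv_add {A B : X → ℝ} {p : X} (hA : ContDiffAt ℝ ∞ A p) (hB : ContDiffAt ℝ ∞ B p)
    (v w : X) :
    secondDeriv (fun q => A q + B q) p w v = secondDeriv A p w v + secondDeriv B p w v := by
  rw [← fderiv_fderiv_apply (hA.add hB)]
  have e : (fun q => fderiv ℝ (fun q => A q + B q) q v)
      =ᶠ[𝓝 p] fun q => fderiv ℝ A q v + fderiv ℝ B q v := by
    filter_upwards [hA.eventually_differentiableAt, hB.eventually_differentiableAt] with q h1 h2
    rw [fderiv_fun_add h1 h2]; rfl
  rw [e.fderiv_eq, ((hasFDerivAt_fderiv_apply hA v).fun_add (hasFDerivAt_fderiv_apply hB v)).fderiv]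
  rfl

theorem fderiv_mul_apply_eq {A B : X → ℝ} {p : X} (hA : DifferentiableAt ℝ A p)
    (hB : DifferentiableAt ℝ B p) (v : X) :
    fderiv ℝ (fun q => A q * B q) p v = A p * fderiv ℝ B p v + B p * fderiv ℝ A p v := by
  rw [fderiv_fun_mul hA hB]; simp

theorem fderiv_smul_left (c : ℝ) (A : X → ℝ) (p : X) :
    fderiv ℝ (fun q => c • A q) p = c • fderiv ℝ A p :=
  congrFun (fderiv_const_smul_field (f := A) c) p

theorem secondDeriv_mul {A B : X → ℝ} {p : X} (hA : ContDiffAt ℝ ∞ A p) (hB : ContDiffAt ℝ ∞ B p)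
    (v w : X) :
    secondDeriv (fun q => A q * B q) p w v = A p * secondDeriv B p w v + B p * secondDeriv A p w v
      + fderiv ℝ A p w * fderiv ℝ B p v + fderiv ℝ B p w * fderiv ℝ A p v := by
  rw [← fderiv_fderiv_apply (hA.mul hB)]
  have e : (fun q => fderiv ℝ (fun q => A q * B q) q v)
      =ᶠ[𝓝 p] fun q => A q * fderiv ℝ B q v + B q * fderiv ℝ A q v := by
    filter_upwards [hA.eventually_differentiableAt, hB.eventually_differentiableAt] with q h1 h2
    exact fderiv_mul_apply_eq h1 h2 v
  have dA := (hA.differentiableAt (by simp)).hasFDerivAt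
  have dB := (hB.differentiableAt (by simp)).hasFDerivAt
  rw [e.fderiv_eq, ((dA.fun_mul (hasFDerivAt_fderiv_apply hB v)).fun_add
    (dB.fun_mul (hasFDerivAt_fderiv_apply hA v))).fderiv]
  simp only [secondDeriv, add_apply, smul_apply,
    ContinuousLinearMap.flip_apply, smul_eq_mul]
  ring

end SecondDerivative

/-! ### Base and fibre derivatives as values of one derivative on the product. -/

section Total

variable {n : ℕ} {E : Type*} [NormedAddCommGroup E] [NormedSpace ℝ E]

/-- A function of base point and fibre vector as a function on the product. -/
abbrev total (L : V n → V n → E) : V n × V n → E := fun p => L p.1 p.2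

theorem isOpen_slit {U : Set (V n)} (hU : IsOpen U) : IsOpen (slit U) :=
  (hU.preimage continuous_fst).inter (isOpen_ne.preimage continuous_snd)

theorem slit_mem_nhds {U : Set (V n)} (hU : IsOpen U) {x y : V n} (hx : x ∈ U) (hy : y ≠ 0) :
    slit U ∈ 𝓝 (x, y) := (isOpen_slit hU).mem_nhds ⟨hx, hy⟩

theorem contDiffAt_total {U : Set (V n)} (hU : IsOpen U) {L : V n → V n → E}
    (h : ContDiffOn ℝ ∞ (total L) (slit U)) {x y : V n} (hx : x ∈ U) (hy : y ≠ 0) :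
    ContDiffAt ℝ ∞ (total L) (x, y) := h.contDiffAt (slit_mem_nhds hU hx hy)

theorem dBase_eq {L : V n → V n → E} {x y : V n} (h : DifferentiableAt ℝ (total L) (x, y))
    (v : V n) : dBase L x y v = fderiv ℝ (total L) (x, y) (v, 0) := by
  have := HasFDerivAt.comp (g := total L) (f := fun x' => (x', y)) x h.hasFDerivAt (hasFDerivAt_prodMk_left x y)
  unfold dBase
  erw [this.fderiv]; simp

theorem dFib_eq {L : V n → V n → E} {x y : V n} (h : DifferentiableAt ℝ (total L) (x, y))
    (v : V n) : dFib L x y v = fderiv ℝ (total L) (x, y) (0, v) := by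
  have := HasFDerivAt.comp (g := total L) (f := fun y' => (x, y')) y h.hasFDerivAt (hasFDerivAt_prodMk_right x y)
  unfold dFib
  erw [this.fderiv]; simp

theorem sprayDeriv_eq {G : V n → V n → V n} {L : V n → V n → E} {x y : V n}
    (h : DifferentiableAt ℝ (total L) (x, y)) :
    sprayDeriv G L x y = fderiv ℝ (total L) (x, y) (y, -((2 : ℝ) • G x y)) := by
  unfold sprayDeriv
  rw [dBase_eq h, dFib_eq h, ← map_smul, ← map_sub]
  simp

theorem dFib_eventuallyEq {L : V n → V n → E} {x y : V n} (h : ContDiffAt ℝ ∞ (total L) (x, y))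
    (v : V n) : (total fun x' y' => dFib L x' y' v)
      =ᶠ[𝓝 (x, y)] fun q => fderiv ℝ (total L) q (0, v) := by
  filter_upwards [h.eventually_differentiableAt] with q hq
  exact dFib_eq hq v

theorem contDiffAt_dFib {L : V n → V n → E} {x y : V n} (h : ContDiffAt ℝ ∞ (total L) (x, y))
    (v : V n) : ContDiffAt ℝ ∞ (total fun x' y' => dFib L x' y' v) (x, y) :=
  ((contDiffAt_fderiv h).clm_apply contDiffAt_const).congr_of_eventuallyEq (dFib_eventuallyEq h v)

/-- Needed for the smoothness of the projective factor S(F')/(2F'). -/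
theorem contDiffAt_sprayDeriv {L : V n → V n → E} {G : V n → V n → V n} {x y : V n}
    (h : ContDiffAt ℝ ∞ (total L) (x, y)) (hG : ContDiffAt ℝ ∞ (total G) (x, y)) :
    ContDiffAt ℝ ∞ (total fun x' y' => sprayDeriv G L x' y') (x, y) := by
  have : ContDiffAt ℝ ∞
      (fun q : V n × V n => fderiv ℝ (total L) q (q.2, -((2 : ℝ) • total G q))) (x, y) :=
    (contDiffAt_fderiv h).clm_apply (contDiffAt_snd.prodMk ((contDiffAt_const (c := (2 : ℝ))).smul hG).neg)
  refine this.congr_of_eventuallyEq ?_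
  filter_upwards [h.eventually_differentiableAt] with q hq
  exact sprayDeriv_eq hq

theorem dFib_dFib_eq {L : V n → V n → ℝ} {x y : V n} (h : ContDiffAt ℝ ∞ (total L) (x, y))
    (v w : V n) : dFib (fun x' y' => dFib L x' y' v) x y w
      = secondDeriv (total L) (x, y) (0, w) (0, v) := by
  rw [dFib_eq ((contDiffAt_dFib h v).differentiableAt (by simp)),
    (dFib_eventuallyEq h v).fderiv_eq, fderiv_fderiv_apply h]

/-- Writing the first term as a single second derivative on the product makes symmetry, bilinearity
and the product rule available for δ_S. -/
theorem eulerLagrange_eq {G : V n → V n → V n} {L : V n → V n → ℝ} {x y : V n}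
    (h : ContDiffAt ℝ ∞ (total L) (x, y)) (v : V n) :
    eulerLagrange G L x y v = secondDeriv (total L) (x, y) (y, -((2 : ℝ) • G x y)) (0, v)
      - fderiv ℝ (total L) (x, y) (v, 0) := by
  unfold eulerLagrange
  rw [sprayDeriv_eq ((contDiffAt_dFib h v).differentiableAt (by simp)),
    (dFib_eventuallyEq h v).fderiv_eq, fderiv_fderiv_apply h,
    dBase_eq (h.differentiableAt (by simp))]

theorem eulerLagrange_congr {G : V n → V n → V n} {L L' : V n → V n → ℝ} {x y : V n}
    (h : ContDiffAt ℝ ∞ (total L) (x, y)) (e : total L =ᶠ[𝓝 (x, y)] total L') (v : V n) :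
    eulerLagrange G L x y v = eulerLagrange G L' x y v := by
  rw [eulerLagrange_eq h, eulerLagrange_eq (h.congr_of_eventuallyEq e.symm),
    secondDeriv_congr e, e.fderiv_eq]

theorem eulerLagrange_add {G : V n → V n → V n} {A B : V n → V n → ℝ} {x y : V n}
    (hA : ContDiffAt ℝ ∞ (total A) (x, y)) (hB : ContDiffAt ℝ ∞ (total B) (x, y)) (v : V n) :
    eulerLagrange G (fun x' y' => A x' y' + B x' y') x y v
      = eulerLagrange G A x y v + eulerLagrange G B x y v := by
  rw [eulerLagrange_eq hA, eulerLagrange_eq hB, eulerLagrange_eq (hA.add hB)]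
  have := secondDeriv_add hA hB (0, v) (y, -((2 : ℝ) • G x y))
  have h2 : fderiv ℝ (fun q => total A q + total B q) (x, y) (v, 0)
      = fderiv ℝ (total A) (x, y) (v, 0) + fderiv ℝ (total B) (x, y) (v, 0) := by
    rw [fderiv_fun_add (hA.differentiableAt (by simp)) (hB.differentiableAt (by simp))]; rfl
  linarith

/-- Since δ_S is of second order, its Leibniz rule has cross terms, each pairing a derivative along
S with a fibre derivative. All later computations of δ_S of squares and quotients go through it. -/
theorem eulerLagrange_mul {G : V n → V n → V n} {A B : V n → V n → ℝ} {x y : V n}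
    (hA : ContDiffAt ℝ ∞ (total A) (x, y)) (hB : ContDiffAt ℝ ∞ (total B) (x, y)) (v : V n) :
    eulerLagrange G (fun x' y' => A x' y' * B x' y') x y v
      = A x y * eulerLagrange G B x y v + B x y * eulerLagrange G A x y v
        + sprayDeriv G A x y * dFib B x y v + sprayDeriv G B x y * dFib A x y v := by
  have dA := hA.differentiableAt (by simp : (∞ : WithTop ℕ∞) ≠ 0)
  have dB := hB.differentiableAt (by simp : (∞ : WithTop ℕ∞) ≠ 0)
  rw [eulerLagrange_eq hA, eulerLagrange_eq hB, eulerLagrange_eq (hA.mul hB), sprayDeriv_eq dA,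
    sprayDeriv_eq dB, dFib_eq dA, dFib_eq dB]
  have h1 := secondDeriv_mul hA hB (0, v) (y, -((2 : ℝ) • G x y))
  have h2 := fderiv_mul_apply_eq dA dB (v, 0)
  simp only [total] at h1 h2 ⊢
  linarith

theorem dFib_mul {A B : V n → V n → ℝ} {x y : V n}
    (hA : DifferentiableAt ℝ (total A) (x, y)) (hB : DifferentiableAt ℝ (total B) (x, y))
    (v : V n) :
    dFib (fun x' y' => A x' y' * B x' y') x y v
      = A x y * dFib B x y v + B x y * dFib A x y v := by
  rw [dFib_eq hA, dFib_eq hB, dFib_eq (hA.mul hB)]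
  exact fderiv_mul_apply_eq hA hB (0, v)

theorem dBase_mul {A B : V n → V n → ℝ} {x y : V n}
    (hA : DifferentiableAt ℝ (total A) (x, y)) (hB : DifferentiableAt ℝ (total B) (x, y))
    (v : V n) :
    dBase (fun x' y' => A x' y' * B x' y') x y v
      = A x y * dBase B x y v + B x y * dBase A x y v := by
  rw [dBase_eq hA, dBase_eq hB, dBase_eq (hA.mul hB)]
  exact fderiv_mul_apply_eq hA hB (v, 0)

theorem sprayDeriv_mul {G : V n → V n → V n} {A B : V n → V n → ℝ} {x y : V n}
    (hA : DifferentiableAt ℝ (total A) (x, y)) (hB : DifferentiableAt ℝ (total B) (x, y)) :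
    sprayDeriv G (fun x' y' => A x' y' * B x' y') x y
      = A x y * sprayDeriv G B x y + B x y * sprayDeriv G A x y := by
  rw [sprayDeriv_eq hA, sprayDeriv_eq hB, sprayDeriv_eq (hA.mul hB)]
  exact fderiv_mul_apply_eq hA hB _

end Total

/-! ### Euler's identity and its consequences for one-homogeneous functions. -/

section Homogeneity

variable {n : ℕ}

/-- Euler's theorem in the fibre. -/
theorem dFib_self {L : V n → V n → ℝ} {x y : V n}
    (h : DifferentiableAt ℝ (total L) (x, y)) (hom : ∀ r : ℝ, 0 < r → L x (r • y) = r * L x y) :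
    dFib L x y y = L x y := by
  have hL : DifferentiableAt ℝ (fun y' => L x y') y :=
    DifferentiableAt.comp (g := total L) y h
      ((differentiableAt_const x).prodMk differentiableAt_id)
  have h1 : HasDerivAt (fun r : ℝ => L x (r • y)) (dFib L x y y) 1 := by
    have hs : HasDerivAt (fun r : ℝ => r • y) y 1 := by
      simpa using (hasDerivAt_id (1 : ℝ)).smul_const y
    have hL' : HasFDerivAt (fun y' => L x y') (fderiv ℝ (fun y' => L x y') y) ((1 : ℝ) • y) := by
      rw [one_smul]; exact hL.hasFDerivAt
    exact hL'.comp_hasDerivAt (1 : ℝ) hs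
  have h2 : HasDerivAt (fun r : ℝ => L x (r • y)) (L x y) 1 := by
    have : HasDerivAt (fun r : ℝ => r * L x y) (L x y) 1 := by
      simpa using (hasDerivAt_id (1 : ℝ)).mul_const (L x y)
    refine this.congr_of_eventuallyEq ?_
    filter_upwards [lt_mem_nhds (zero_lt_one (α := ℝ))] with r hr using hom r hr
  exact h1.unique h2

variable {U : Set (V n)} {L : V n → V n → ℝ}

theorem IsOneHomogeneous.contDiffAt (hU : IsOpen U) (hL : IsOneHomogeneous U L) {x y : V n}
    (hx : x ∈ U) (hy : y ≠ 0) : ContDiffAt ℝ ∞ (total L) (x, y) :=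
  contDiffAt_total hU hL.smooth hx hy

theorem IsOneHomogeneous.differentiableAt (hU : IsOpen U) (hL : IsOneHomogeneous U L) {x y : V n}
    (hx : x ∈ U) (hy : y ≠ 0) : DifferentiableAt ℝ (total L) (x, y) :=
  (hL.contDiffAt hU hx hy).differentiableAt (by simp)

theorem IsOneHomogeneous.dFib_self (hU : IsOpen U) (hL : IsOneHomogeneous U L) {x y : V n}
    (hx : x ∈ U) (hy : y ≠ 0) : dFib L x y y = L x y :=
  ProjFinsler.dFib_self (hL.differentiableAt hU hx hy) (hL.homog x hx y hy)

theorem IsFinsler.isOneHomogeneous (h : IsFinsler U L) : IsOneHomogeneous U L :=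
  ⟨h.smooth, fun x hx y _ r hr => h.homog x hx y r hr⟩

/-- Differentiate Euler's identity yⁱ ∂L/∂yⁱ = L along w: the fibre part of w contributes the same
first-order term to both sides and cancels. For vertical w this says that the fibre Hessian kills y.
-/
theorem IsOneHomogeneous.secondDeriv_fib (hU : IsOpen U) (hL : IsOneHomogeneous U L) {x y : V n}
    (hx : x ∈ U) (hy : y ≠ 0) (w : V n × V n) :
    secondDeriv (total L) (x, y) w (0, y) = fderiv ℝ (total L) (x, y) (w.1, 0) := by
  have hc := hL.contDiffAt hU hx hy
  have e : (fun q : V n × V n => fderiv ℝ (total L) q (0, q.2)) =ᶠ[𝓝 (x, y)] total L := by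
    filter_upwards [slit_mem_nhds hU hx hy] with q hq
    rw [← dFib_eq (x := q.1) (y := q.2) (hL.differentiableAt hU hq.1 hq.2) q.2]
    exact hL.dFib_self hU hq.1 hq.2
  have h1 := (differentiableAt_fderiv hc).hasFDerivAt.clm_apply
    ((hasFDerivAt_const (0 : V n) (x, y)).prodMk (hasFDerivAt_snd (p := (x, y)) (𝕜 := ℝ)))
  have h2 := congrArg (fun T => T w) (e.fderiv_eq.symm.trans h1.fderiv)
  simp at h2
  have h3 : w = (w.1, 0) + (0, w.2) := by simp
  have h4 : fderiv ℝ (total L) (x, y) w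
      = fderiv ℝ (total L) (x, y) (w.1, 0) + fderiv ℝ (total L) (x, y) (0, w.2) := by
    rw [← map_add, ← h3]
  unfold secondDeriv
  linarith

/-- The Euler-Lagrange form of a one-homogeneous function is a projective invariant. -/
theorem IsOneHomogeneous.eulerLagrange_projective (hU : IsOpen U) (hL : IsOneHomogeneous U L)
    {G G' : V n → V n → V n} {x y : V n} (hx : x ∈ U) (hy : y ≠ 0) {P : ℝ}
    (hG : G' x y = G x y + P • y) (v : V n) :
    eulerLagrange G' L x y v = eulerLagrange G L x y v := by
  have hc := hL.contDiffAt hU hx hy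
  rw [eulerLagrange_eq hc, eulerLagrange_eq hc]
  have h0 : secondDeriv (total L) (x, y) (0, y) (0, v) = 0 := by
    rw [secondDeriv_symm hc, hL.secondDeriv_fib hU hx hy]
    exact map_zero _
  have h1 : ((y, -((2 : ℝ) • G' x y)) : V n × V n)
      = (y, -((2 : ℝ) • G x y)) + (-(2 * P)) • (0, y) := by
    rw [hG]; ext1 <;> simp [smul_smul]; abel
  have : secondDeriv (total L) (x, y) (y, -((2 : ℝ) • G' x y)) (0, v)
      = secondDeriv (total L) (x, y) (y, -((2 : ℝ) • G x y)) (0, v)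
        + (-(2 * P)) * secondDeriv (total L) (x, y) (0, y) (0, v) := by
    rw [h1]; unfold secondDeriv; rw [map_add, map_smul]; rfl
  rw [this, h0]; ring

/-- Contracted with y, both terms of δ_S L become yⁱ ∂L/∂xⁱ. -/
theorem IsOneHomogeneous.eulerLagrange_self (hU : IsOpen U) (hL : IsOneHomogeneous U L)
    {G : V n → V n → V n} {x y : V n} (hx : x ∈ U) (hy : y ≠ 0) :
    eulerLagrange G L x y y = 0 := by
  rw [eulerLagrange_eq (hL.contDiffAt hU hx hy), hL.secondDeriv_fib hU hx hy]; simp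

theorem IsOneHomogeneous.eulerLagrange_sq (hU : IsOpen U) (hL : IsOneHomogeneous U L)
    {G : V n → V n → V n} {x y : V n} (hx : x ∈ U) (hy : y ≠ 0) (v : V n) :
    eulerLagrange G (fun x' y' => L x' y' ^ 2) x y v
      = 2 * (L x y * eulerLagrange G L x y v + sprayDeriv G L x y * dFib L x y v) := by
  have hc := hL.contDiffAt hU hx hy
  simp only [pow_two]
  rw [eulerLagrange_mul hc hc]; ring

/-- The square of a one-homogeneous function satisfies the Euler-Lagrange equation if and only if
the function does and is constant along the spray. -/
theorem IsOneHomogeneous.eulerLagrange_sq_eq_zero_iff (hU : IsOpen U) (hL : IsOneHomogeneous U L)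
    {G : V n → V n → V n} {x y : V n} (hx : x ∈ U) (hy : y ≠ 0) (h0 : L x y ≠ 0) :
    (∀ v, eulerLagrange G (fun x' y' => L x' y' ^ 2) x y v = 0) ↔
      (∀ v, eulerLagrange G L x y v = 0) ∧ sprayDeriv G L x y = 0 := by
  simp only [hL.eulerLagrange_sq hU hx hy]
  constructor
  · intro h
    -- At v = y the form δ_S L vanishes and d_J L equals L, which isolates L · S(L).
    have h1 : sprayDeriv G L x y = 0 := by
      have := h y
      rw [hL.eulerLagrange_self hU hx hy, hL.dFib_self hU hx hy] at this
      simpa [h0] using this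
    refine ⟨fun v => ?_, h1⟩
    have := h v
    simpa [h1, h0] using this
  · rintro ⟨h1, h2⟩ v
    simp [h1, h2]

theorem IsOneHomogeneous.sprayDeriv_projective (hU : IsOpen U) (hL : IsOneHomogeneous U L)
    {G G' : V n → V n → V n} {x y : V n} (hx : x ∈ U) (hy : y ≠ 0) {P : ℝ}
    (hG : G' x y = G x y + P • y) :
    sprayDeriv G' L x y = sprayDeriv G L x y - 2 * P * L x y := by
  have h := hL.dFib_self hU hx hy
  have e : dFib L x y (G x y + P • y) = dFib L x y (G x y) + P * dFib L x y y := by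
    simp [dFib]
  unfold sprayDeriv
  rw [hG, e, h]; simp only [smul_eq_mul]; ring

end Homogeneity

/-! ### Geodesic sprays, their uniqueness, and projective relatedness. -/

section Projective

variable {n : ℕ} {U : Set (V n)}

theorem metricTensor_eq {F : V n → V n → ℝ} {x y : V n} (h : ContDiffAt ℝ ∞ (total F) (x, y))
    (v w : V n) :
    metricTensor F x y v w
      = (1 / 2) * secondDeriv (total fun x' y' => F x' y' ^ 2) (x, y) (0, w) (0, v) := by
  unfold metricTensor
  rw [dFib_dFib_eq (L := fun x' y' => F x' y' ^ 2) (h.pow 2)]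

theorem IsFinsler.isGeodesicSpray_iff (hU : IsOpen U) {F : V n → V n → ℝ} {G : V n → V n → V n}
    (hF : IsFinsler U F) (hG : IsSpray U G) :
    IsGeodesicSpray U F G ↔ ∀ x ∈ U, ∀ y : V n, y ≠ 0 →
      (∀ v, eulerLagrange G F x y v = 0) ∧ sprayDeriv G F x y = 0 := by
  have key := fun x (hx : x ∈ U) (y : V n) (hy : y ≠ 0) =>
    hF.isOneHomogeneous.eulerLagrange_sq_eq_zero_iff hU (G := G) hx hy (hF.pos x hx y hy).ne'
  exact ⟨fun h x hx y hy => (key x hx y hy).1 (h.eulerLagrange_sq x hx y hy),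
    fun h => ⟨hG, fun x hx y hy => (key x hx y hy).2 (h x hx y hy)⟩⟩

/-- The geodesic spray of a Finsler metric is unique on the slit tangent bundle. -/
theorem IsFinsler.geodesicSpray_unique (hU : IsOpen U) {F : V n → V n → ℝ}
    {G G' : V n → V n → V n} (hF : IsFinsler U F) (hG : IsGeodesicSpray U F G)
    (hG' : IsGeodesicSpray U F G') {x y : V n} (hx : x ∈ U) (hy : y ≠ 0) : G x y = G' x y := by
  have hc := contDiffAt_total hU hF.smooth hx hy
  have hc2 : ContDiffAt ℝ ∞ (total fun x' y' => F x' y' ^ 2) (x, y) := hc.pow 2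
  -- The two Euler-Lagrange equations of F² differ only in the vertical second-derivative term, so
  -- their difference says that G − G' is in the kernel of the metric tensor.
  refine sub_eq_zero.1 (hF.nondegenerate x hx y hy _ fun w => ?_)
  have h1 := hG.eulerLagrange_sq x hx y hy w
  have h2 := hG'.eulerLagrange_sq x hx y hy w
  rw [eulerLagrange_eq hc2] at h1 h2
  rw [metricTensor_eq hc, secondDeriv_symm hc2]
  have h3 : ((y, -((2 : ℝ) • G x y)) : V n × V n)
      = (y, -((2 : ℝ) • G' x y)) + (-2 : ℝ) • (0, G x y - G' x y) := by
    ext1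
    · simp
    · simp only [Prod.snd_add, Prod.smul_snd]; module
  have h4 : secondDeriv (total fun x' y' => F x' y' ^ 2) (x, y) (y, -((2 : ℝ) • G x y)) (0, w)
      = secondDeriv (total fun x' y' => F x' y' ^ 2) (x, y) (y, -((2 : ℝ) • G' x y)) (0, w)
        + (-2) * secondDeriv (total fun x' y' => F x' y' ^ 2) (x, y)
          (0, G x y - G' x y) (0, w) := by
    rw [h3]; unfold secondDeriv; rw [map_add, map_smul]; rfl
  linarith

/-- A spray raises degree by one: in yⁱ ∂L/∂xⁱ both factors have degree one, and in Gⁱ ∂L/∂yⁱ the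
degrees are two and zero. This makes S(F')/(2F') one-homogeneous. -/
theorem IsOneHomogeneous.sprayDeriv_smul (hU : IsOpen U) {L : V n → V n → ℝ}
    (hL : IsOneHomogeneous U L) {G : V n → V n → V n} (hG : IsSpray U G) {x y : V n}
    (hx : x ∈ U) (hy : y ≠ 0) {r : ℝ} (hr : 0 < r) :
    sprayDeriv G L x (r • y) = r ^ 2 * sprayDeriv G L x y := by
  have h1 : dBase L x (r • y) (r • y) = r ^ 2 * dBase L x y y := by
    have e : (fun x' => L x' (r • y)) =ᶠ[𝓝 x] fun x' => r • L x' y := by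
      filter_upwards [hU.mem_nhds hx] with x' hx' using hL.homog x' hx' y hy r hr
    unfold dBase
    rw [e.fderiv_eq, fderiv_smul_left, map_smul]
    simp only [smul_apply, smul_eq_mul]
    ring
  have h2 : fderiv ℝ (L x) (r • y) = fderiv ℝ (L x) y := by
    have e : (fun z => L x (r • z)) =ᶠ[𝓝 y] fun z => r • L x z := by
      filter_upwards [isOpen_ne.mem_nhds hy] with z hz using hL.homog x hx z hz r hr
    have := e.fderiv_eq (𝕜 := ℝ)
    have h3 : fderiv ℝ (fun z => L x (r • z)) y = r • fderiv ℝ (L x) (r • y) :=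
      fderiv_comp_smul (𝕜 := ℝ) (f := L x) (c := r)
    rw [h3, fderiv_smul_left] at this
    ext w
    have h := congrArg (fun T => T w) this
    simp only [smul_apply, smul_eq_mul] at h
    exact mul_left_cancel₀ hr.ne' h
  unfold sprayDeriv
  rw [h1, hG.homog x hx y hy r hr]
  unfold dFib
  rw [h2, map_smul]
  simp only [smul_eq_mul]
  ring

theorem IsSpray.add_smul_self {G : V n → V n → V n} {P : V n → V n → ℝ} (hG : IsSpray U G)
    (hP : IsOneHomogeneous U P) : IsSpray U (fun x y => G x y + P x y • y) := by
  refine ⟨hG.smooth.add (hP.smooth.smul contDiffOn_snd), fun x hx y hy r hr => ?_⟩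
  rw [hG.homog x hx y hy r hr, hP.homog x hx y hy r hr]
  module

/-- If the Euler-Lagrange form of a Finsler metric vanishes along a spray, then its geodesic spray
is a projective deformation of that spray. -/
theorem IsFinsler.isGeodesicSpray_add (hU : IsOpen U) {F P : V n → V n → ℝ}
    {G : V n → V n → V n} (hF : IsFinsler U F) (hG : IsSpray U G) (hP : IsOneHomogeneous U P)
    (hEL : ∀ x ∈ U, ∀ y : V n, y ≠ 0 → ∀ v, eulerLagrange G F x y v = 0)
    (hS : ∀ x ∈ U, ∀ y : V n, y ≠ 0 → sprayDeriv G F x y = 2 * P x y * F x y) :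
    IsGeodesicSpray U F (fun x y => G x y + P x y • y) := by
  refine (hF.isGeodesicSpray_iff hU (hG.add_smul_self hP)).2 fun x hx y hy => ⟨fun v => ?_, ?_⟩
  · rw [hF.isOneHomogeneous.eulerLagrange_projective hU (G := G) hx hy rfl]
    exact hEL x hx y hy v
  · rw [hF.isOneHomogeneous.sprayDeriv_projective hU (G := G) hx hy rfl, hS x hx y hy, sub_self]

/-- Rapcsák's criterion. -/
theorem IsFinsler.isProjectivelyRelated_iff (hU : IsOpen U) {F F' : V n → V n → ℝ}
    {G : V n → V n → V n} (hF : IsFinsler U F) (hF' : IsFinsler U F')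
    (hG : IsGeodesicSpray U F G) :
    IsProjectivelyRelated U F F' ↔
      ∀ x ∈ U, ∀ y : V n, y ≠ 0 → ∀ v, eulerLagrange G F' x y v = 0 := by
  have hL := hF'.isOneHomogeneous
  constructor
  · rintro ⟨P, -, -, -, G₀, G', hG₀, hG', hGG⟩ x hx y hy v
    have h := ((hF'.isGeodesicSpray_iff hU hG'.isSpray).1 hG' x hx y hy).1 v
    rw [← h]
    refine (hL.eulerLagrange_projective hU hx hy (P := P x y) ?_ v).symm
    rw [hGG x hx y hy, hF.geodesicSpray_unique hU hG₀ hG hx hy]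
  · intro h
    -- The factor is forced: S' = S − 2P𝒞 must satisfy 0 = S'(F') = S(F') − 2PF'.
    have hP : IsOneHomogeneous U (fun x y => sprayDeriv G F' x y / (2 * F' x y)) := by
      refine ⟨fun p hp => ContDiffAt.contDiffWithinAt ?_, fun x hx y hy r hr => ?_⟩
      · have h1 := contDiffAt_total hU hF'.smooth hp.1 hp.2
        have h2 := contDiffAt_total hU hG.isSpray.smooth hp.1 hp.2
        refine (contDiffAt_sprayDeriv h1 h2).div (contDiffAt_const.mul h1) ?_
        exact mul_ne_zero two_ne_zero (hF'.pos p.1 hp.1 p.2 hp.2).ne'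
      · rw [hL.sprayDeriv_smul hU hG.isSpray hx hy hr, hL.homog x hx y hy r hr]
        have := (hF'.pos x hx y hy).ne'
        field_simp
    refine ⟨_, hF, hF', hP, G, _, hG, hF'.isGeodesicSpray_add hU hG.isSpray hP h ?_,
      fun x _ y _ => rfl⟩
    intro x hx y hy
    have := (hF'.pos x hx y hy).ne'
    field_simp

end Projective

/-! ### The Euler-Lagrange form of f F² / a. -/

section Deformation

variable {n : ℕ} {U : Set (V n)}

/-- The fibre derivative of a linear form does not depend on y, so the coefficients G drop out and
what remains is the exterior derivative of β paired with y and v. -/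
theorem eulerLagrange_closedForm {β : V n → V n →L[ℝ] ℝ} (hU : IsOpen U)
    (hβ : IsClosedForm U β) (G : V n → V n → V n) {x : V n} (hx : x ∈ U) (y v : V n) :
    eulerLagrange G (fun x' y' => β x' y') x y v = 0 := by
  have hd : DifferentiableAt ℝ β x :=
    (hβ.smooth.contDiffAt (hU.mem_nhds hx)).differentiableAt (by simp)
  have h1 : ∀ w : V n, fderiv ℝ (fun x' => β x' w) x = (fderiv ℝ β x).flip w := fun w => by
    simpa using (hd.hasFDerivAt.clm_apply (hasFDerivAt_const w x)).fderiv
  have h2 : (fun x' y' => dFib (fun x' y' => β x' y') x' y' v) = fun x' (_ : V n) => β x' v := by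
    funext x' y'
    exact congrArg (fun T => T v) (β x').fderiv
  unfold eulerLagrange
  rw [h2]
  unfold sprayDeriv dBase dFib
  rw [h1, h1]
  simp [hβ.closed x hx y v]

variable {G : V n → V n → V n} {f : V n → ℝ}

theorem dFib_base (x y v : V n) : dFib (fun x' _ => f x') x y v = 0 := by
  simp [dFib]

/-- The Euler-Lagrange form of `f F² / a` along a spray that annihilates `F` and for which `a`
satisfies the Euler-Lagrange equation. -/
theorem eulerLagrange_deform {F a : V n → V n → ℝ} {x y : V n}
    (hf : ContDiffAt ℝ ∞ f x) (hF : ContDiffAt ℝ ∞ (total F) (x, y))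
    (ha : ContDiffAt ℝ ∞ (total a) (x, y)) (ha0 : a x y ≠ 0) (v : V n)
    (hELF : eulerLagrange G F x y v = 0) (hSF : sprayDeriv G F x y = 0)
    (hELa : eulerLagrange G a x y v = 0) :
    eulerLagrange G (deform f F a) x y v =
      -(F x y ^ 2 / a x y * horizDeriv G (fun x' _ => f x') x y v
        - sprayDeriv G (fun x' _ => f x') x y * dFib (fun x' y' => F x' y' ^ 2 / a x' y') x y v
        + f x * sprayDeriv G a x y * dFib (fun x' y' => F x' y' ^ 2 / a x' y' ^ 2) x y v) := by
  set Q : V n → V n → ℝ := fun x' y' => F x' y' ^ 2 / a x' y' with hQdef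
  set R : V n → V n → ℝ := fun x' y' => F x' y' ^ 2 / a x' y' ^ 2 with hRdef
  have hne : ∀ᶠ q in 𝓝 (x, y), total a q ≠ 0 := ha.continuousAt.eventually_ne ha0
  have hQ : ContDiffAt ℝ ∞ (total Q) (x, y) := (hF.pow 2).div ha ha0
  have hR : ContDiffAt ℝ ∞ (total R) (x, y) := (hF.pow 2).div (ha.pow 2) (pow_ne_zero 2 ha0)
  have hf' : ContDiffAt ℝ ∞ (total fun x' (_ : V n) => f x') (x, y) :=
    ContDiffAt.comp (x, y) (g := f) (f := Prod.fst) hf contDiffAt_fst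
  have dd := fun {A : V n × V n → ℝ} (h : ContDiffAt ℝ ∞ A (x, y)) =>
    h.differentiableAt (by simp : (∞ : WithTop ℕ∞) ≠ 0)
  -- The quotients are handled through the products Q a = F² and R a = Q, so that only Leibniz rules
  -- are needed.
  have hQa : total (fun x' y' => Q x' y' * a x' y') =ᶠ[𝓝 (x, y)]
      total fun x' y' => F x' y' * F x' y' := by
    filter_upwards [hne] with q hq
    simp only [total] at hq ⊢
    simp only [hQdef]
    field_simp
  have hRa : total (fun x' y' => R x' y' * a x' y') =ᶠ[𝓝 (x, y)] total Q := by
    filter_upwards [hne] with q hq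
    simp only [total] at hq ⊢
    simp only [hRdef, hQdef]
    field_simp
  have e1 := eulerLagrange_congr (G := G) (hQ.mul ha) hQa v
  rw [eulerLagrange_mul hQ ha, eulerLagrange_mul hF hF, hELF, hSF, hELa] at e1
  have e2 : sprayDeriv G (fun x' y' => Q x' y' * a x' y') x y
      = sprayDeriv G (fun x' y' => F x' y' * F x' y') x y := by
    rw [sprayDeriv_eq (dd (hQ.mul ha)), sprayDeriv_eq (dd (hF.mul hF)), hQa.fderiv_eq]
  rw [sprayDeriv_mul (dd hQ) (dd ha), sprayDeriv_mul (dd hF) (dd hF), hSF] at e2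
  have e3 : dFib (fun x' y' => R x' y' * a x' y') x y v = dFib Q x y v := by
    rw [dFib_eq (dd (hR.mul ha)), dFib_eq (dd hQ), hRa.fderiv_eq]
  rw [dFib_mul (dd hR) (dd ha)] at e3
  have e4 : R x y * a x y = Q x y := hRa.self_of_nhds
  have e5 : eulerLagrange G (fun x' _ => f x') x y v = -dBase (fun x' _ => f x') x y v := by
    have : (fun x' y' => dFib (fun x' (_ : V n) => f x') x' y' v) = fun _ _ => 0 := by
      funext x' y'; exact dFib_base x' y' v
    unfold eulerLagrange
    rw [this]
    simp [sprayDeriv, dBase, dFib]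
  have e6 : horizDeriv G (fun x' _ => f x') x y v = dBase (fun x' _ => f x') x y v := by
    unfold horizDeriv; rw [dFib_base, sub_zero]
  have e7 := eulerLagrange_mul (G := G) hf' hQ v
  rw [e5, dFib_base] at e7
  -- S(F) = 0 gives S(Q) = −R S(a). Inserting this and d_J Q = R d_J a + a d_J R into δ_S(Qa) = 0
  -- cancels the d_J a terms.
  have e8 : eulerLagrange G Q x y v = -sprayDeriv G a x y * dFib R x y v := by
    have hS : a x y * sprayDeriv G Q x y = -(R x y * a x y * sprayDeriv G a x y) := by
      rw [e4]; linarith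
    have hS' : sprayDeriv G Q x y = -(R x y * sprayDeriv G a x y) := by
      apply mul_left_cancel₀ ha0; linarith
    rw [hS', ← e3] at e1
    apply mul_left_cancel₀ ha0
    linarith
  have e9 : Q x y = F x y ^ 2 / a x y := rfl
  rw [e6, ← e9]
  rw [e8] at e7
  change eulerLagrange G (fun x' y' => f x' * Q x' y') x y v = _
  rw [e7]
  ring

end Deformation

/-! ### A Hessian criterion for nondegeneracy of the metric tensor. -/

section Nondegeneracy

variable {n : ℕ} {U : Set (V n)}

/-- The metric tensor is L · Hess L + d_J L ⊗ d_J L. Pairing a kernel vector v with y removes the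
Hessian and gives d_J L(v) = 0; pairing v with itself then gives Hess L(v, v) = 0. Hence only the
kernel of d_J L has to be examined. -/
theorem IsOneHomogeneous.nondegenerate (hU : IsOpen U) {L : V n → V n → ℝ}
    (hL : IsOneHomogeneous U L) {x y : V n} (hx : x ∈ U) (hy : y ≠ 0) (h0 : L x y ≠ 0)
    (H : ∀ v, dFib L x y v = 0 → secondDeriv (total L) (x, y) (0, v) (0, v) = 0 → v = 0)
    (v : V n) (hv : ∀ w, metricTensor L x y v w = 0) : v = 0 := by
  have hc := hL.contDiffAt hU hx hy
  have hm : ∀ w, L x y * secondDeriv (total L) (x, y) (0, w) (0, v)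
      + dFib L x y w * dFib L x y v = 0 := fun w => by
    have h1 := hv w
    unfold metricTensor at h1
    rw [dFib_dFib_eq (L := fun x' y' => L x' y' ^ 2) (hc.pow 2)] at h1
    simp only [pow_two] at h1
    have h2 := secondDeriv_mul hc hc (0, v) (0, w)
    rw [dFib_eq (hc.differentiableAt (by simp)), dFib_eq (hc.differentiableAt (by simp))]
    simp only [total] at h1 h2 ⊢
    rw [h2] at h1
    linarith
  have h1 := hm y
  rw [secondDeriv_symm hc, hL.secondDeriv_fib hU hx hy, hL.dFib_self hU hx hy] at h1
  have h2 : dFib L x y v = 0 := by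
    have : L x y * dFib L x y v = 0 := by
      have h3 : fderiv ℝ (total L) (x, y) ((0 : V n), (0 : V n)) = 0 := map_zero _
      simpa [h3] using h1
    exact (mul_eq_zero.1 this).resolve_left h0
  refine H v h2 ?_
  have h3 := hm v
  rw [h2] at h3
  simpa [h0] using h3

end Nondegeneracy

/-! ### Randers metrics and their deformations are Finsler metrics. -/

section Randers

variable {n : ℕ} {U : Set (V n)} {g : V n → V n →L[ℝ] V n →L[ℝ] ℝ} {β : V n → V n →L[ℝ] ℝ}

theorem IsRiemannian.nonneg (hg : IsRiemannian U g) {x : V n} (hx : x ∈ U) (y : V n) :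
    0 ≤ g x y y := by
  rcases eq_or_ne y 0 with rfl | hy
  · simp
  · exact (hg.posDef x hx y hy).le

theorem IsRiemannian.riemNorm_pos (hg : IsRiemannian U g) {x y : V n} (hx : x ∈ U) (hy : y ≠ 0) :
    0 < riemNorm g x y := Real.sqrt_pos.2 (hg.posDef x hx y hy)

theorem IsRiemannian.riemNorm_mul_self (hg : IsRiemannian U g) {x : V n} (hx : x ∈ U) (y : V n) :
    riemNorm g x y * riemNorm g x y = g x y y := Real.mul_self_sqrt (hg.nonneg hx y)

theorem contDiffOn_apply_apply (hg : ContDiffOn ℝ ∞ g U) :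
    ContDiffOn ℝ ∞ (fun p : V n × V n => g p.1 p.2 p.2) (U ×ˢ Set.univ) :=
  ((hg.comp contDiffOn_fst fun _ h => h.1).clm_apply contDiffOn_snd).clm_apply contDiffOn_snd

theorem contDiffOn_apply (hβ : ContDiffOn ℝ ∞ β U) :
    ContDiffOn ℝ ∞ (fun p : V n × V n => β p.1 p.2) (U ×ˢ Set.univ) :=
  (hβ.comp contDiffOn_fst fun _ h => h.1).clm_apply contDiffOn_snd

theorem slit_subset (U : Set (V n)) : slit U ⊆ U ×ˢ Set.univ := fun _ h => ⟨h.1, trivial⟩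

theorem IsRiemannian.isOneHomogeneous (hg : IsRiemannian U g) :
    IsOneHomogeneous U (riemNorm g) := by
  refine ⟨((contDiffOn_apply_apply hg.smooth).mono (slit_subset U)).sqrt
    fun p hp => (hg.posDef p.1 hp.1 p.2 hp.2).ne', fun x hx y _ r hr => ?_⟩
  have : g x (r • y) (r • y) = r ^ 2 * g x y y := by simp; ring
  unfold riemNorm
  rw [this, Real.sqrt_mul (by positivity), Real.sqrt_sq hr.le]

theorem IsRiemannian.riemNorm_continuousOn (hg : IsRiemannian U g) :
    ContinuousOn (total (riemNorm g)) (U ×ˢ Set.univ) :=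
  (contDiffOn_apply_apply hg.smooth).continuousOn.sqrt

theorem IsRiemannian.dFib_sq (hg : IsRiemannian U g) {x : V n} (hx : x ∈ U) (y v : V n) :
    dFib (fun x' y' => g x' y' y') x y v = 2 * g x y v := by
  have h : HasFDerivAt (fun y' => g x y' y') _ y :=
    ((g x).hasFDerivAt (x := y)).clm_apply (hasFDerivAt_id y)
  unfold dFib
  rw [h.fderiv]
  simp [hg.symm x hx v y]; ring

theorem IsRiemannian.mul_dFib (hU : IsOpen U) (hg : IsRiemannian U g) {x y : V n} (hx : x ∈ U)
    (hy : y ≠ 0) (v : V n) : riemNorm g x y * dFib (riemNorm g) x y v = g x y v := by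
  have hd := hg.isOneHomogeneous.differentiableAt hU hx hy
  have h1 := dFib_mul hd hd v
  have h2 : dFib (fun x' y' => riemNorm g x' y' * riemNorm g x' y') x y v
      = dFib (fun x' y' => g x' y' y') x y v := by
    unfold dFib; simp only [hg.riemNorm_mul_self hx]
  rw [h2, hg.dFib_sq hx] at h1
  linarith

/-- Obtained by differentiating a² = g(y, y) twice along v. -/
theorem IsRiemannian.mul_secondDeriv (hU : IsOpen U) (hg : IsRiemannian U g) {x y : V n}
    (hx : x ∈ U) (hy : y ≠ 0) (v : V n) :
    riemNorm g x y * secondDeriv (total (riemNorm g)) (x, y) (0, v) (0, v)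
      = g x v v - dFib (riemNorm g) x y v ^ 2 := by
  have hc := hg.isOneHomogeneous.contDiffAt hU hx hy
  have hd := hc.differentiableAt (by simp : (∞ : WithTop ℕ∞) ≠ 0)
  have h1 := secondDeriv_mul hc hc (0, v) (0, v)
  rw [← dFib_eq hd] at h1
  have h2 := dFib_dFib_eq (L := fun x' y' => riemNorm g x' y' * riemNorm g x' y')
    (hc.mul hc) v v
  have h3 : dFib (fun x' y' => dFib (fun x' y' => riemNorm g x' y' * riemNorm g x' y') x' y' v)
      x y v = 2 * g x v v := by
    have e : (fun y' => dFib (fun x' y' => riemNorm g x' y' * riemNorm g x' y') x y' v)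
        = fun y' => (2 : ℝ) • g x y' v := by
      funext y'
      rw [smul_eq_mul, ← hg.dFib_sq hx]
      unfold dFib; simp only [hg.riemNorm_mul_self hx]
    change fderiv ℝ (fun y' => dFib (fun x' y' => riemNorm g x' y' * riemNorm g x' y') x y' v)
      y v = _
    have h : HasFDerivAt (fun y' => (2 : ℝ) • g x y' v) _ y :=
      (((g x).hasFDerivAt (x := y)).clm_apply (hasFDerivAt_const v y)).fun_const_smul 2
    rw [e, h.fderiv]
    simp
  rw [h3] at h2
  simp only [total] at h1 h2 ⊢
  linarith

/-- The Hessian of the norm of a Riemannian metric is the metric on the orthogonal part. -/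
theorem IsRiemannian.mul_secondDeriv' (hU : IsOpen U) (hg : IsRiemannian U g) {x y : V n}
    (hx : x ∈ U) (hy : y ≠ 0) (v : V n) :
    riemNorm g x y * secondDeriv (total (riemNorm g)) (x, y) (0, v) (0, v)
      = g x (v - (dFib (riemNorm g) x y v / riemNorm g x y) • y)
          (v - (dFib (riemNorm g) x y v / riemNorm g x y) • y) := by
  have h0 := (hg.riemNorm_pos hx hy).ne'
  rw [hg.mul_secondDeriv hU hx hy]
  simp only [map_sub, map_smul, sub_apply, smul_apply, smul_eq_mul]
  rw [hg.symm x hx v y, ← hg.mul_dFib hU hx hy, ← hg.riemNorm_mul_self hx y]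
  field_simp
  ring

theorem secondDeriv_linear (hU : IsOpen U) (hβ : ContDiffOn ℝ ∞ β U) {x y : V n} (hx : x ∈ U)
    (v w : V n) : secondDeriv (total fun x' y' => β x' y') (x, y) (0, w) (0, v) = 0 := by
  have hc : ContDiffAt ℝ ∞ (total fun x' y' => β x' y') (x, y) :=
    (contDiffOn_apply hβ).contDiffAt ((hU.prod isOpen_univ).mem_nhds ⟨hx, trivial⟩)
  rw [← dFib_dFib_eq hc]
  have : (fun y' => dFib (fun x' y' => β x' y') x y' v) = fun _ => β x v := by
    funext y'
    exact congrArg (fun T => T v) (β x).fderiv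
  change fderiv ℝ (fun y' => dFib (fun x' y' => β x' y') x y' v) y w = 0
  rw [this]; simp

theorem secondDeriv_randersOf (hU : IsOpen U) (hg : IsRiemannian U g) (hβ : ContDiffOn ℝ ∞ β U)
    {x y : V n} (hx : x ∈ U) (hy : y ≠ 0) (v : V n) :
    secondDeriv (total (randersOf g β)) (x, y) (0, v) (0, v)
      = secondDeriv (total (riemNorm g)) (x, y) (0, v) (0, v) := by
  have h := secondDeriv_add (hg.isOneHomogeneous.contDiffAt hU hx hy)
    ((contDiffOn_apply hβ).contDiffAt ((hU.prod isOpen_univ).mem_nhds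
      (show (x, y) ∈ U ×ˢ Set.univ from ⟨hx, trivial⟩))) (0, v) (0, v)
  have h2 := secondDeriv_linear hU hβ (y := y) hx v v
  simp only [total] at h h2
  rw [h2, add_zero] at h
  exact h

theorem IsRiemannian.randersOf_isOneHomogeneous (hg : IsRiemannian U g)
    (hβ : ContDiffOn ℝ ∞ β U) : IsOneHomogeneous U (randersOf g β) := by
  refine ⟨hg.isOneHomogeneous.smooth.add ((contDiffOn_apply hβ).mono (slit_subset U)),
    fun x hx y hy r hr => ?_⟩
  unfold randersOf
  rw [hg.isOneHomogeneous.homog x hx y hy r hr, map_smul, smul_eq_mul, mul_add]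

/-- A Randers metric is a Finsler metric as soon as it is positive. -/
theorem IsRiemannian.randersOf_isFinsler (hU : IsOpen U) (hg : IsRiemannian U g)
    (hβ : ContDiffOn ℝ ∞ β U) (hpos : ∀ x ∈ U, ∀ y : V n, y ≠ 0 → 0 < randersOf g β x y) :
    IsFinsler U (randersOf g β) := by
  have hL := hg.randersOf_isOneHomogeneous hβ
  refine ⟨hg.riemNorm_continuousOn.add (contDiffOn_apply hβ).continuousOn, hL.smooth, hpos,
    fun x hx y r hr => ?_, fun x hx y hy => ?_⟩
  · rcases eq_or_ne y 0 with rfl | hy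
    · simp [randersOf, riemNorm]
    · exact hL.homog x hx y hy r hr
  · refine hL.nondegenerate hU hx hy (hpos x hx y hy).ne' fun v h1 h2 => ?_
    rw [secondDeriv_randersOf hU hg hβ hx hy] at h2
    have h3 := hg.mul_secondDeriv' hU hx hy v
    rw [h2, mul_zero] at h3
    set t := dFib (riemNorm g) x y v / riemNorm g x y
    -- The Hessian of a is, up to the factor a, the metric on the component g-orthogonal to y; its
    -- vanishing makes v a multiple of y, and d_J F(y) = F ≠ 0 then kills the multiple.
    have h4 : v = t • y := by
      by_contra h
      exact (hg.posDef x hx _ (sub_ne_zero.2 h)).ne h3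
    have h5 : dFib (randersOf g β) x y v = t * dFib (randersOf g β) x y y := by
      conv_lhs => rw [h4]
      simp [dFib]
    rw [h5, hL.dFib_self hU hx hy] at h1
    rw [h4, (mul_eq_zero.1 h1).resolve_right (hpos x hx y hy).ne', zero_smul]

/-- Positivity at y and at −y bounds β from both sides, because the norm is even and β is odd. -/
theorem abs_lt_riemNorm (hpos : ∀ x ∈ U, ∀ y : V n, y ≠ 0 → 0 < randersOf g β x y) {x y : V n}
    (hx : x ∈ U) (hy : y ≠ 0) : |β x y| < riemNorm g x y := by
  have h1 := hpos x hx y hy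
  have h2 := hpos x hx (-y) (neg_ne_zero.2 hy)
  simp only [randersOf, riemNorm, map_neg, neg_apply, neg_neg] at h1 h2 ⊢
  rw [abs_lt]; constructor <;> linarith

/-- The deformation `f F² / a` of a Randers metric `F = a + b` is a Finsler metric. -/
theorem IsRiemannian.deform_isFinsler (hU : IsOpen U) (hg : IsRiemannian U g)
    (hβ : ContDiffOn ℝ ∞ β U) (hpos : ∀ x ∈ U, ∀ y : V n, y ≠ 0 → 0 < randersOf g β x y)
    {f : V n → ℝ} (hf : ContDiffOn ℝ ∞ f U) (hf0 : ∀ x ∈ U, 0 < f x) :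
    IsFinsler U (deform f (randersOf g β) (riemNorm g)) := by
  set F := randersOf g β with hFdef
  set a := riemNorm g with hadef
  have hF : IsOneHomogeneous U F := hg.randersOf_isOneHomogeneous hβ
  have ha : IsOneHomogeneous U a := hg.isOneHomogeneous
  have hfs : ContDiffOn ℝ ∞ (fun p : V n × V n => f p.1) (U ×ˢ Set.univ) :=
    hf.comp contDiffOn_fst fun _ h => h.1
  have hapos : ∀ x ∈ U, ∀ y : V n, y ≠ 0 → 0 < a x y := fun x hx y hy => hg.riemNorm_pos hx hy
  have hQs : ContDiffOn ℝ ∞ (total fun x y => F x y ^ 2 / a x y) (slit U) :=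
    (hF.smooth.pow 2).div ha.smooth fun p hp => (hapos p.1 hp.1 p.2 hp.2).ne'
  have hs : ContDiffOn ℝ ∞ (total (deform f F a)) (slit U) := (hfs.mono (slit_subset U)).mul hQs
  have hp : ∀ x ∈ U, ∀ y : V n, y ≠ 0 → 0 < deform f F a x y := fun x hx y hy =>
    mul_pos (hf0 x hx) (div_pos (pow_pos (hpos x hx y hy) 2) (hapos x hx y hy))
  have hzero : ∀ x, deform f F a x 0 = 0 := fun x => by simp [deform, hFdef, hadef, randersOf, riemNorm]
  have hL : IsOneHomogeneous U (deform f F a) := by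
    refine ⟨hs, fun x hx y hy r hr => ?_⟩
    have := (hapos x hx y hy).ne'
    unfold deform
    rw [hF.homog x hx y hy r hr, ha.homog x hx y hy r hr]
    field_simp
  refine ⟨?_, hs, hp, fun x hx y r hr => ?_, fun x hx y hy => ?_⟩
  · rintro ⟨x, y⟩ ⟨hx, -⟩
    rcases eq_or_ne y 0 with rfl | hy
    -- Continuity is in doubt only at y = 0. There 0 < F ≤ 2a bounds f F²/a by 4fa, which is
    -- continuous and vanishes at y = 0.
    · have h1 : ContinuousOn (fun p : V n × V n => f p.1 * (4 * a p.1 p.2)) (U ×ˢ Set.univ) :=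
        hfs.continuousOn.mul (continuousOn_const.mul hg.riemNorm_continuousOn)
      have h2 := h1 (x, 0) ⟨hx, trivial⟩
      unfold ContinuousWithinAt at h2 ⊢
      have h3 : a x 0 = 0 := by simp [hadef, riemNorm]
      simp only [h3, mul_zero] at h2
      simp only [hzero]
      refine squeeze_zero' ?_ ?_ h2
      · filter_upwards [self_mem_nhdsWithin] with q hq
        rcases eq_or_ne q.2 0 with h | h
        · rw [h, hzero]
        · exact (hp q.1 hq.1 q.2 h).le
      · filter_upwards [self_mem_nhdsWithin] with q hq
        rcases eq_or_ne q.2 0 with h | h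
        · rw [h, hzero]; simp [hadef, riemNorm]
        · refine mul_le_mul_of_nonneg_left ?_ (hf0 q.1 hq.1).le
          rw [div_le_iff₀ (hapos q.1 hq.1 q.2 h)]
          have h4 := abs_lt.1 (abs_lt_riemNorm hpos hq.1 h)
          have h5 := hpos q.1 hq.1 q.2 h
          have h6 : F q.1 q.2 = a q.1 q.2 + β q.1 q.2 := rfl
          change 0 < F q.1 q.2 at h5
          have h7 : F q.1 q.2 ≤ 2 * a q.1 q.2 := by rw [h6]; linarith [h4.2]
          nlinarith
    · exact (hs.contDiffAt (slit_mem_nhds hU hx hy)).continuousAt.continuousWithinAt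
  · rcases eq_or_ne y 0 with rfl | hy
    · simp [hzero]
    · exact hL.homog x hx y hy r hr
  · refine hL.nondegenerate hU hx hy (hp x hx y hy).ne' fun v h1 h2 => ?_
    have hac := ha.contDiffAt hU hx hy
    have hFc := hF.contDiffAt hU hx hy
    have hLc := hL.contDiffAt hU hx hy
    have hfc : ContDiffAt ℝ ∞ (total fun x' (_ : V n) => f x') (x, y) :=
      hfs.contDiffAt ((hU.prod isOpen_univ).mem_nhds ⟨hx, trivial⟩)
    have dd := fun {A : V n × V n → ℝ} (h : ContDiffAt ℝ ∞ A (x, y)) =>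
      h.differentiableAt (by simp : (∞ : WithTop ℕ∞) ≠ 0)
    have e : (fun y' => deform f F a x y' * a x y') =ᶠ[𝓝 y]
        fun y' => f x • (F x y' * F x y') := by
      filter_upwards [isOpen_ne.mem_nhds hy] with z hz
      have := (hapos x hx z hz).ne'
      simp only [deform, smul_eq_mul]; field_simp
    have e1 : ∀ᶠ z in 𝓝 y, dFib (fun x' y' => deform f F a x' y' * a x' y') x z v
        = f x • dFib (fun x' y' => F x' y' * F x' y') x z v := by
      filter_upwards [e.eventuallyEq_nhds] with z hz
      unfold dFib
      rw [hz.fderiv_eq, fderiv_smul_left]; rfl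
    have e2 : dFib (fun x' y' => dFib (fun x' y' => deform f F a x' y' * a x' y') x' y' v) x y v
        = f x * dFib (fun x' y' => dFib (fun x' y' => F x' y' * F x' y') x' y' v) x y v := by
      have := EventuallyEq.fderiv_eq (𝕜 := ℝ) e1
      rw [fderiv_smul_left] at this
      exact congrArg (fun T => T v) this
    have e1' := e1.self_of_nhds
    rw [dFib_mul (dd hLc) (dd hac), dFib_mul (dd hFc) (dd hFc), h1, smul_eq_mul] at e1'
    rw [dFib_dFib_eq (hLc.mul hac), dFib_dFib_eq (hFc.mul hFc)] at e2
    have e3 := secondDeriv_mul hLc hac (0, v) (0, v)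
    have e4 := secondDeriv_mul hFc hFc (0, v) (0, v)
    rw [← dFib_eq (dd hLc), ← dFib_eq (dd hac), h1, h2] at e3
    rw [← dFib_eq (dd hFc), secondDeriv_randersOf hU hg hβ hx hy] at e4
    have e0 : deform f F a x y * a x y = f x * (F x y * F x y) := e.self_of_nhds
    have hA := hapos x hx y hy
    have hf1 := hf0 x hx
    have hF1 : 0 < F x y := hpos x hx y hy
    have hlt : F x y < 2 * a x y := by
      have h6 : F x y = a x y + β x y := rfl
      rw [h6]; linarith [(abs_lt.1 (abs_lt_riemNorm hpos hx hy)).2]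
    have hH := hg.mul_secondDeriv hU hx hy v
    have hH' := hg.mul_secondDeriv' hU hx hy v
    have hnn := hg.nonneg hx (v - (dFib (riemNorm g) x y v / riemNorm g x y) • y)
    rw [← hH'] at hnn
    simp only [total] at e2 e3 e4 hH hnn
    rw [e3, e4] at e2
    change 0 ≤ a x y * _ at hnn
    change a x y * _ = _ at hH
    set H := secondDeriv (fun p : V n × V n => a p.1 p.2) (x, y) (0, v) (0, v)
    have hH0 : 0 ≤ H := nonneg_of_mul_nonneg_right hnn hA
    set Fv := dFib F x y v
    -- Write L for the deformation. Differentiating L a = f F² twice along v, with L_v = L_vv = 0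
    -- and F_vv = a_vv = H because b is linear, gives L H = 2f(F H + F_v²). Multiplying by a and
    -- replacing L a by f F² leaves two terms that are nonnegative because F < 2a, so both vanish.
    have key : a x y * Fv ^ 2 * 2 + H * (F x y * (2 * a x y - F x y)) = 0 := by
      have h7 : f x * (a x y * Fv ^ 2 * 2 + H * (F x y * (2 * a x y - F x y))) = 0 := by
        linear_combination (-(a x y)) * e2 + H * e0
      exact (mul_eq_zero.1 h7).resolve_left hf1.ne'
    have hpp : 0 < F x y * (2 * a x y - F x y) := mul_pos hF1 (by linarith)
    have t1 : 0 ≤ a x y * Fv ^ 2 * 2 := by positivity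
    have t2 : 0 ≤ H * (F x y * (2 * a x y - F x y)) := mul_nonneg hH0 hpp.le
    have hHz : H = 0 := (mul_eq_zero.1 (by linarith :
      H * (F x y * (2 * a x y - F x y)) = 0)).resolve_right hpp.ne'
    have hFz : Fv = 0 := by
      have h8 : a x y * Fv ^ 2 * 2 = 0 := by linarith
      have h9 : Fv ^ 2 = 0 := by
        have := mul_eq_zero.1 ((mul_eq_zero.1 h8).resolve_right two_ne_zero)
        exact this.resolve_left hA.ne'
      exact pow_eq_zero_iff two_ne_zero |>.1 h9
    have haz : dFib a x y v = 0 := by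
      rw [hFz] at e1'
      simp only [mul_zero, add_zero] at e1'
      exact (mul_eq_zero.1 e1').resolve_left (hp x hx y hy).ne'
    rw [hHz, haz] at hH
    by_contra hv
    have := hg.posDef x hx v hv
    linarith

end Randers

/-! ### The criterion for Randers metrics with closed b. -/

section Criterion

variable {n : ℕ} {U : Set (V n)} {g : V n → V n →L[ℝ] V n →L[ℝ] ℝ} {β : V n → V n →L[ℝ] ℝ}

theorem isProjectivelyRelated_deform_iff (hU : IsOpen U) (hg : IsRiemannian U g)
    (hβ : IsClosedForm U β) (hF : IsFinsler U (randersOf g β)) {f : V n → ℝ}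
    (hf : ContDiffOn ℝ ∞ f U) (hf0 : ∀ x ∈ U, 0 < f x) {G : V n → V n → V n}
    (hG : IsGeodesicSpray U (randersOf g β) G) :
    IsProjectivelyRelated U (randersOf g β) (deform f (randersOf g β) (riemNorm g)) ↔
      ∀ x ∈ U, ∀ y : V n, y ≠ 0 → ∀ v : V n,
        randersOf g β x y ^ 2 / riemNorm g x y * horizDeriv G (fun x' _ => f x') x y v
          - sprayDeriv G (fun x' _ => f x') x y
              * dFib (fun x' y' => randersOf g β x' y' ^ 2 / riemNorm g x' y') x y v
          + f x * sprayDeriv G (riemNorm g) x y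
              * dFib (fun x' y' => randersOf g β x' y' ^ 2 / riemNorm g x' y' ^ 2) x y v
          = 0 := by
  rw [hF.isProjectivelyRelated_iff hU (hg.deform_isFinsler hU hβ.smooth hF.pos hf hf0) hG]
  refine forall₂_congr fun x hx => forall₂_congr fun y hy => forall_congr' fun v => ?_
  have ha := hg.isOneHomogeneous.contDiffAt hU hx hy
  have hb : ContDiffAt ℝ ∞ (total fun x' y' => β x' y') (x, y) :=
    (contDiffOn_apply hβ.smooth).contDiffAt ((hU.prod isOpen_univ).mem_nhds ⟨hx, trivial⟩)
  obtain ⟨hEL, hS⟩ := (hF.isGeodesicSpray_iff hU hG.isSpray).1 hG x hx y hy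
  -- Closedness of β enters here: δ_S a = δ_S F − δ_S b.
  have hELa : eulerLagrange G (riemNorm g) x y v = 0 := by
    have h := eulerLagrange_add (G := G) ha hb v
    rw [eulerLagrange_closedForm hU hβ G hx, add_zero] at h
    rw [← h]; exact hEL v
  rw [eulerLagrange_deform (hf.contDiffAt (hU.mem_nhds hx))
    (hF.isOneHomogeneous.contDiffAt hU hx hy) ha (hg.riemNorm_pos hx hy).ne' v (hEL v) hS hELa,
    neg_eq_zero]

end Criterion

/-! ### Sprays with coefficients P yⁱ: Euler-Lagrange equations, curvature, geodesics. -/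

section FlatDeformation

variable {n : ℕ} {U : Set (V n)}

theorem isSpray_zero : IsSpray U (fun _ _ : V n => 0) :=
  ⟨contDiffOn_const, fun _ _ _ _ _ _ => by simp⟩

theorem sprayDeriv_zero_of_dBase (hU : IsOpen U) {L P : V n → V n → ℝ} (hL : IsOneHomogeneous U L)
    (hP : IsOneHomogeneous U P) {x y : V n} (hx : x ∈ U) (hy : y ≠ 0)
    (h : dBase L x y y = P x y * dFib L x y y + L x y * dFib P x y y) :
    sprayDeriv (fun _ _ => 0) L x y = 2 * P x y * L x y := by
  rw [hL.dFib_self hU hx hy, hP.dFib_self hU hx hy] at h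
  simp only [sprayDeriv, h, dFib, map_zero, smul_zero]
  ring

/-- If `∂L/∂xⁱ = ∂(PL)/∂yⁱ`, then `L` satisfies the Euler-Lagrange equation of the flat spray. -/
theorem eulerLagrange_zero_of_dBase (hU : IsOpen U) {L P : V n → V n → ℝ}
    (hL : IsOneHomogeneous U L) (hP : IsOneHomogeneous U P)
    (h : ∀ x ∈ U, ∀ y : V n, y ≠ 0 → ∀ v,
      dBase L x y v = P x y * dFib L x y v + L x y * dFib P x y v)
    {x y : V n} (hx : x ∈ U) (hy : y ≠ 0) (v : V n) :
    eulerLagrange (fun _ _ => 0) L x y v = 0 := by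
  have hc := hL.contDiffAt hU hx hy
  have hd := hL.differentiableAt hU hx hy
  have hdP := hP.differentiableAt hU hx hy
  -- Contracting the hypothesis with y gives yⁱ ∂L/∂xⁱ = 2PL. A fibre derivative of this, compared
  -- with twice the hypothesis, is the Euler-Lagrange equation.
  have e : (fun q : V n × V n => fderiv ℝ (total L) q (q.2, 0))
      =ᶠ[𝓝 (x, y)] fun q => (2 : ℝ) • (total P q * total L q) := by
    filter_upwards [slit_mem_nhds hU hx hy] with q hq
    rw [← dBase_eq (x := q.1) (y := q.2) (hL.differentiableAt hU hq.1 hq.2) q.2,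
      h q.1 hq.1 q.2 hq.2, hL.dFib_self hU hq.1 hq.2, hP.dFib_self hU hq.1 hq.2, smul_eq_mul]
    ring
  have h1 := (differentiableAt_fderiv hc).hasFDerivAt.clm_apply
    ((hasFDerivAt_snd (p := (x, y)) (𝕜 := ℝ)).prodMk (hasFDerivAt_const (0 : V n) (x, y)))
  have h2 := congrArg (fun T => T (0, v)) (h1.fderiv.symm.trans e.fderiv_eq)
  rw [fderiv_smul_left] at h2
  have h3 := fderiv_mul_apply_eq hdP hd (0, v)
  simp only [add_apply, smul_apply, ContinuousLinearMap.comp_apply,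
    ContinuousLinearMap.flip_apply, ContinuousLinearMap.prod_apply, zero_apply,
    ContinuousLinearMap.coe_snd', smul_eq_mul] at h2
  rw [h3, ← dFib_eq hd, ← dFib_eq hdP, ← dBase_eq hd] at h2
  have h4 := secondDeriv_symm hc (y, 0) (0, v)
  rw [eulerLagrange_eq hc, ← dBase_eq hd, smul_zero, neg_zero]
  have h5 := h x hx y hy v
  unfold secondDeriv at h4 ⊢
  simp only [total] at *
  linarith

/-- If `∂F/∂xⁱ = ∂(PF)/∂yⁱ`, then the geodesic spray of `F` has the coefficients `P yⁱ`. -/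
theorem IsFinsler.isGeodesicSpray_smul (hU : IsOpen U) {F P : V n → V n → ℝ} (hF : IsFinsler U F)
    (hP : IsOneHomogeneous U P)
    (h : ∀ x ∈ U, ∀ y : V n, y ≠ 0 → ∀ v,
      dBase F x y v = P x y * dFib F x y v + F x y * dFib P x y v) :
    IsGeodesicSpray U F (fun x y => P x y • y) := by
  have := hF.isGeodesicSpray_add hU isSpray_zero hP
    (fun x hx y hy v => eulerLagrange_zero_of_dBase hU hF.isOneHomogeneous hP h hx hy v)
    (fun x hx y hy =>
      sprayDeriv_zero_of_dBase hU hF.isOneHomogeneous hP hx hy (h x hx y hy y))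
  simpa using this

theorem dFib_const_mul (c : ℝ) (P : V n → V n → ℝ) (x y v : V n) :
    dFib (fun x' y' => c * P x' y') x y v = c * dFib P x y v :=
  congrArg (fun T => T v) (fderiv_smul_left c (fun y' => P x y') y)

theorem dBase_const_mul (c : ℝ) (P : V n → V n → ℝ) (x y v : V n) :
    dBase (fun x' y' => c * P x' y') x y v = c * dBase P x y v :=
  congrArg (fun T => T v) (fderiv_smul_left c (fun x' => P x' y) x)

theorem IsOneHomogeneous.const_mul {P : V n → V n → ℝ} (hP : IsOneHomogeneous U P) (c : ℝ) :
    IsOneHomogeneous U (fun x y => c * P x y) :=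
  ⟨contDiffOn_const.mul hP.smooth, fun x hx y hy r hr => by rw [hP.homog x hx y hy r hr]; ring⟩

theorem dFib_smul_self {P : V n → V n → ℝ} {x y : V n} (h : DifferentiableAt ℝ (total P) (x, y))
    (v : V n) :
    dFib (fun x' y' => P x' y' • y') x y v = dFib P x y v • y + P x y • v := by
  have hP : HasFDerivAt (fun y' => P x y') (fderiv ℝ (fun y' => P x y') y) y :=
    (DifferentiableAt.comp (g := total P) y h
      ((differentiableAt_const x).prodMk differentiableAt_id)).hasFDerivAt
  unfold dFib
  erw [(hP.smul (hasFDerivAt_id y)).fderiv]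
  simp [add_comm]

theorem dBase_smul_self {P : V n → V n → ℝ} {x y : V n} (h : DifferentiableAt ℝ (total P) (x, y))
    (v : V n) : dBase (fun x' y' => P x' y' • y') x y v = dBase P x y v • y := by
  have hP : HasFDerivAt (fun x' => P x' y) (fderiv ℝ (fun x' => P x' y) x) x :=
    (DifferentiableAt.comp (g := total P) (f := fun x' => (x', y)) x h
      (differentiableAt_fun_id.prodMk (differentiableAt_const y))).hasFDerivAt
  unfold dBase
  rw [(hP.smul_const y).fderiv]
  simp

/-- If `∂P/∂xⁱ = P ∂P/∂yⁱ`, then the spray with coefficients `P yⁱ` has vanishing Jacobi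
endomorphism. -/
theorem jacobi_smul_self (hU : IsOpen U) {P : V n → V n → ℝ} (hP : IsOneHomogeneous U P)
    (h : ∀ x ∈ U, ∀ y : V n, y ≠ 0 → ∀ v, dBase P x y v = P x y * dFib P x y v)
    {x y : V n} (hx : x ∈ U) (hy : y ≠ 0) (v : V n) :
    jacobi (fun x y => P x y • y) x y v = 0 := by
  have hc := hP.contDiffAt hU hx hy
  have hd := hP.differentiableAt hU hx hy
  set G : V n → V n → V n := fun x y => P x y • y with hG
  have hN : ∀ x ∈ U, ∀ y : V n, y ≠ 0 → ∀ v, conn G x y v = dFib P x y v • y + P x y • v :=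
    fun x hx y hy v => dFib_smul_self (hP.differentiableAt hU hx hy) v
  have hPN : ∀ v, dFib P x y (conn G x y v) = 2 * P x y * dFib P x y v := fun v => by
    have : dFib P x y (dFib P x y v • y + P x y • v)
        = dFib P x y v * dFib P x y y + P x y * dFib P x y v := by simp [dFib]
    rw [hN x hx y hy, this, hP.dFib_self hU hx hy]; ring
  have hsP : sprayDeriv G P x y = -(P x y * P x y) := by
    rw [hP.sprayDeriv_projective hU (G := fun _ _ => 0) (P := P x y) hx hy (by simp [hG])]
    have h1 := h x hx y hy y
    rw [hP.dFib_self hU hx hy] at h1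
    simp only [sprayDeriv, h1, dFib, map_zero, smul_zero]
    ring
  have hEL : eulerLagrange G P x y v = 0 := by
    rw [hP.eulerLagrange_projective hU (G := fun _ _ => 0) (P := P x y) hx hy (by simp [hG])]
    -- The factor is P/2, since P ∂P/∂yⁱ = ∂(P²/2)/∂yⁱ.
    refine eulerLagrange_zero_of_dBase hU hP (hP.const_mul (1 / 2)) (fun x hx y hy v => ?_) hx hy v
    rw [dFib_const_mul, h x hx y hy]; ring
  have hsD : sprayDeriv G (fun x' y' => dFib P x' y' v) x y = P x y * dFib P x y v := by
    rw [← h x hx y hy v]; exact sub_eq_zero.1 hEL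
  have hα := contDiffAt_dFib hc v
  have hdα := hα.differentiableAt (by simp : (∞ : WithTop ℕ∞) ≠ 0)
  have hS : sprayDeriv G (fun x' y' => conn G x' y' v) x y
      = -(P x y * dFib P x y v) • y - (P x y * P x y) • v := by
    have e : total (fun x' y' => conn G x' y' v) =ᶠ[𝓝 (x, y)]
        fun q => total (fun x' y' => dFib P x' y' v) q • q.2 + total P q • v := by
      filter_upwards [slit_mem_nhds hU hx hy] with q hq using hN q.1 hq.1 q.2 hq.2 v
    have hD := (hdα.hasFDerivAt.smul (hasFDerivAt_snd (p := (x, y)) (𝕜 := ℝ))).add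
      (hd.hasFDerivAt.smul_const v)
    have hD' := hD.congr_of_eventuallyEq e
    rw [sprayDeriv_eq hD'.differentiableAt, hD'.fderiv]
    simp only [add_apply, smul_apply, ContinuousLinearMap.smulRight_apply,
      ContinuousLinearMap.coe_snd']
    rw [← sprayDeriv_eq hdα, ← sprayDeriv_eq hd, hsP, hsD]
    simp only [total, hG]
    module
  have hH : horizDeriv G G x y v
      = -(2 * (P x y * dFib P x y v)) • y - (P x y * P x y) • v := by
    unfold horizDeriv
    rw [dBase_smul_self hd, dFib_smul_self hd, hPN, hN x hx y hy, h x hx y hy]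
    module
  -- The three terms contribute −4, 1, 3 times P d_J P(v) y and −2, 1, 1 times P² v.
  unfold jacobi
  rw [hS, hH, hN x hx y hy (conn G x y v), hPN, hN x hx y hy v]
  module

/-- Geodesics of a spray with coefficients `P yⁱ` are pieces of straight lines. -/
theorem IsGeodesic.collinear {P : V n → V n → ℝ} {γ : ℝ → V n} {s t : ℝ}
    (h : IsGeodesic U (fun x y => P x y • y) γ s t) : Collinear ℝ (γ '' Set.Ioo s t) := by
  rcases (Set.Ioo s t).eq_empty_or_nonempty with h0 | ⟨τ₀, hτ₀⟩
  · simp [h0, collinear_empty]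
  have hpos : ∀ τ ∈ Set.Ioo s t, 0 < ‖deriv γ τ‖ := fun τ hτ => norm_pos_iff.2 (h τ hτ).2.2.1
  -- The acceleration is parallel to the velocity, so the unit tangent is constant.
  have hn : ∀ τ ∈ Set.Ioo s t,
      HasDerivAt (fun τ => ‖deriv γ τ‖⁻¹ • deriv γ τ) 0 τ := fun τ hτ => by
    have h1 := (h τ hτ).2.2.2
    have hp := hpos τ hτ
    have h2 := (h1.norm_sq).sqrt (by positivity)
    simp only [Real.sqrt_sq (norm_nonneg _)] at h2
    have h3 := (h2.fun_inv hp.ne').smul h1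
    refine h3.congr_deriv ?_
    simp only [inner_neg_right, inner_smul_right, real_inner_self_eq_norm_sq]
    rw [smul_neg, smul_smul, smul_smul, ← neg_smul, ← add_smul]
    refine smul_eq_zero_of_left ?_ _
    field_simp
    ring
  set u := ‖deriv γ τ₀‖⁻¹ • deriv γ τ₀ with hu
  have hu1 : inner ℝ u u = (1 : ℝ) := by
    have := (hpos τ₀ hτ₀).ne'
    rw [real_inner_self_eq_norm_sq, hu, norm_smul, norm_inv, norm_norm, inv_mul_cancel₀ this,
      one_pow]
  have hconst : ∀ τ ∈ Set.Ioo s t, ‖deriv γ τ‖⁻¹ • deriv γ τ = u := fun τ hτ =>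
    isOpen_Ioo.is_const_of_deriv_eq_zero isPreconnected_Ioo
      (fun τ hτ => (hn τ hτ).differentiableAt.differentiableWithinAt)
      (fun τ hτ => (hn τ hτ).deriv) hτ hτ₀
  have hdir : ∀ τ ∈ Set.Ioo s t, deriv γ τ = ‖deriv γ τ‖ • u := fun τ hτ => by
    rw [← hconst τ hτ, smul_smul, mul_inv_cancel₀ (hpos τ hτ).ne', one_smul]
  -- The component of γ orthogonal to the fixed direction u is constant, which gives the base point
  -- of the line.
  have hd : ∀ τ ∈ Set.Ioo s t,
      HasDerivAt (fun τ => γ τ - (inner ℝ u (γ τ) : ℝ) • u) 0 τ := fun τ hτ => by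
    have h1 := (h τ hτ).2.1.hasDerivAt
    have h2 : HasDerivAt (fun τ => (inner ℝ u (γ τ) : ℝ)) (inner ℝ u (deriv γ τ)) τ := by
      simpa using (hasDerivAt_const τ u).inner ℝ h1
    refine (h1.sub (h2.smul_const u)).congr_deriv ?_
    rw [hdir τ hτ, inner_smul_right, hu1, mul_one, sub_self]
  rw [collinear_iff_exists_forall_eq_smul_vadd]
  refine ⟨γ τ₀ - (inner ℝ u (γ τ₀) : ℝ) • u, u, ?_⟩
  rintro _ ⟨τ, hτ, rfl⟩
  refine ⟨inner ℝ u (γ τ), ?_⟩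
  have := isOpen_Ioo.is_const_of_deriv_eq_zero isPreconnected_Ioo
      (fun τ hτ => (hd τ hτ).differentiableAt.differentiableWithinAt)
      (fun τ hτ => (hd τ hτ).deriv) hτ₀ hτ
  rw [this, vadd_eq_add]; abel

theorem IsFinsler.isProjectivelyFlat {F P : V n → V n → ℝ} (hF : IsFinsler U F)
    (h : IsGeodesicSpray U F (fun x y => P x y • y)) : IsProjectivelyFlat U F :=
  ⟨hF, _, h, fun _ _ _ hγ => hγ.collinear⟩

/-- The metric tensor differentiates only along a fixed fibre, so agreement over U suffices. This
transfers the general Randers results to the explicit formulas, which are matched with them on the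
domain. -/
theorem IsFinsler.congr {F F' : V n → V n → ℝ} (hF : IsFinsler U F)
    (h : ∀ x ∈ U, ∀ y, F' x y = F x y) : IsFinsler U F' := by
  have h' : ∀ x ∈ U, F' x = F x := fun x hx => funext (h x hx)
  refine ⟨hF.continuousOn.congr fun p hp => h _ hp.1 _, hF.smooth.congr fun p hp => h _ hp.1 _,
    fun x hx y hy => by rw [h x hx]; exact hF.pos x hx y hy,
    fun x hx y r hr => by rw [h x hx, h x hx]; exact hF.homog x hx y r hr,
    fun x hx y hy v hv => hF.nondegenerate x hx y hy v fun w => ?_⟩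
  have := hv w
  unfold metricTensor dFib at this ⊢
  simpa only [h' x hx] using this

end FlatDeformation

/-! ### The explicit family on 4c²|x|² < 1 and its differential equations. -/

section Family

variable {n : ℕ}

/-- The Euclidean inner product as a bilinear form. -/
noncomputable def euclidForm (n : ℕ) : V n →L[ℝ] V n →L[ℝ] ℝ := innerSL ℝ

@[simp] theorem euclidForm_apply (x y : V n) : euclidForm n x y = inner ℝ x y := rfl

/-- The Riemannian metric whose norm is `aPart c`. -/
noncomputable def familyMetric (c : ℝ) (x : V n) : V n →L[ℝ] V n →L[ℝ] ℝ :=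
  (1 - 4 * c ^ 2 * ‖x‖ ^ 2)⁻¹ • euclidForm n
    + (4 * c ^ 2 * ((1 - 4 * c ^ 2 * ‖x‖ ^ 2) ^ 2)⁻¹) •
      (euclidForm n x).smulRight (euclidForm n x)

/-- The 1-form whose fibrewise value is `bPart c`. -/
noncomputable def familyForm (c : ℝ) (x : V n) : V n →L[ℝ] ℝ :=
  (2 * c * (1 - 4 * c ^ 2 * ‖x‖ ^ 2)⁻¹) • euclidForm n x

variable {c : ℝ} {x : V n}

theorem isOpen_dom (n : ℕ) (c : ℝ) : IsOpen (dom n c) :=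
  isOpen_lt (by fun_prop) continuous_const

theorem dom_pos (hx : x ∈ dom n c) : 0 < 1 - 4 * c ^ 2 * ‖x‖ ^ 2 := sub_pos.2 hx

theorem contDiff_conformal (n : ℕ) (c : ℝ) :
    ContDiff ℝ ∞ (fun x : V n => 1 - 4 * c ^ 2 * ‖x‖ ^ 2) :=
  contDiff_const.sub (contDiff_const.mul (contDiff_norm_sq ℝ))

theorem contDiffOn_inv (n : ℕ) (c : ℝ) :
    ContDiffOn ℝ ∞ (fun x : V n => (1 - 4 * c ^ 2 * ‖x‖ ^ 2)⁻¹) (dom n c) :=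
  (contDiff_conformal n c).contDiffOn.inv fun _ hx => (dom_pos hx).ne'

theorem familyMetric_apply (hx : x ∈ dom n c) (v w : V n) :
    familyMetric c x v w = ((1 - 4 * c ^ 2 * ‖x‖ ^ 2) * inner ℝ v w
      + 4 * c ^ 2 * (inner ℝ x v * inner ℝ x w)) / (1 - 4 * c ^ 2 * ‖x‖ ^ 2) ^ 2 := by
  have := (dom_pos hx).ne'
  simp only [familyMetric, add_apply, smul_apply, ContinuousLinearMap.smulRight_apply,
    euclidForm_apply, smul_eq_mul]
  field_simp

theorem isRiemannian_familyMetric (n : ℕ) (c : ℝ) :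
    IsRiemannian (dom n c) (familyMetric (n := n) c) := by
  refine ⟨?_, fun x hx v w => ?_, fun x hx v hv => ?_⟩
  · refine contDiffOn_clm_apply.2 fun v => contDiffOn_clm_apply.2 fun w =>
      ContDiffOn.congr ?_ fun x hx => familyMetric_apply hx v w
    have hi : ∀ u : V n, ContDiff ℝ ∞ (fun x : V n => (inner ℝ x u : ℝ)) := fun u =>
      contDiff_id.inner ℝ contDiff_const
    exact (((contDiff_conformal n c).mul contDiff_const).add
      (contDiff_const.mul ((hi v).mul (hi w)))).contDiffOn.div
      ((contDiff_conformal n c).pow 2).contDiffOn fun x hx => pow_ne_zero 2 (dom_pos hx).ne'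
  · rw [familyMetric_apply hx, familyMetric_apply hx, real_inner_comm w v]
    ring
  · rw [familyMetric_apply hx]
    have h1 := dom_pos hx
    have h2 : 0 < inner ℝ v v := real_inner_self_pos.2 hv
    have h3 := mul_self_nonneg (inner ℝ x v)
    positivity

theorem riemNorm_familyMetric (hx : x ∈ dom n c) (y : V n) :
    riemNorm (familyMetric c) x y = aPart c x y := by
  unfold riemNorm aPart rad
  rw [familyMetric_apply hx, Real.sqrt_div' _ (by positivity), Real.sqrt_sq (dom_pos hx).le,
    real_inner_self_eq_norm_sq]
  congr 2; ring

theorem familyForm_apply (x y : V n) : familyForm c x y = bPart c x y := by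
  simp only [familyForm, bPart, smul_apply, euclidForm_apply, smul_eq_mul]
  ring

theorem contDiffOn_familyForm (n : ℕ) (c : ℝ) :
    ContDiffOn ℝ ∞ (familyForm (n := n) c) (dom n c) :=
  (contDiffOn_const.mul (contDiffOn_inv n c)).smul (euclidForm n).contDiff.contDiffOn

theorem randersOf_family (hx : x ∈ dom n c) (y : V n) :
    randersOf (familyMetric c) (familyForm c) x y = randers c x y := by
  unfold randersOf randers
  rw [riemNorm_familyMetric hx, familyForm_apply]

/-- In this form the radicand visibly exceeds (2c⟨x,y⟩)² on the domain for y ≠ 0, whence |b| < a and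
F > 0. -/
theorem radicand_eq (c : ℝ) (x y : V n) :
    ‖y‖ ^ 2 - 4 * c ^ 2 * (‖x‖ ^ 2 * ‖y‖ ^ 2 - inner ℝ x y ^ 2)
      = (1 - 4 * c ^ 2 * ‖x‖ ^ 2) * ‖y‖ ^ 2 + (2 * c * inner ℝ x y) ^ 2 := by ring

theorem radicand_pos (hx : x ∈ dom n c) {y : V n} (hy : y ≠ 0) :
    (2 * c * inner ℝ x y) ^ 2
      < ‖y‖ ^ 2 - 4 * c ^ 2 * (‖x‖ ^ 2 * ‖y‖ ^ 2 - inner ℝ x y ^ 2) := by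
  rw [radicand_eq]
  have h1 := dom_pos hx
  have h2 := norm_pos_iff.2 hy
  have : 0 < (1 - 4 * c ^ 2 * ‖x‖ ^ 2) * ‖y‖ ^ 2 := by positivity
  linarith

theorem rad_pos (hx : x ∈ dom n c) {y : V n} (hy : y ≠ 0) : 0 < rad c x y :=
  Real.sqrt_pos.2 ((sq_nonneg _).trans_lt (radicand_pos hx hy))

theorem rad_mul_self (hx : x ∈ dom n c) {y : V n} (hy : y ≠ 0) :
    rad c x y * rad c x y = ‖y‖ ^ 2 - 4 * c ^ 2 * (‖x‖ ^ 2 * ‖y‖ ^ 2 - inner ℝ x y ^ 2) :=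
  Real.mul_self_sqrt ((sq_nonneg _).trans (radicand_pos hx hy).le)

theorem randers_pos (hx : x ∈ dom n c) {y : V n} (hy : y ≠ 0) : 0 < randers c x y := by
  have h1 : |2 * c * inner ℝ x y| < rad c x y := by
    rw [← Real.sqrt_sq_eq_abs]
    exact Real.sqrt_lt_sqrt (sq_nonneg _) (radicand_pos hx hy)
  have h2 := (abs_lt.1 h1).1
  unfold randers aPart bPart
  rw [← add_div]
  exact div_pos (by linarith) (dom_pos hx)

theorem randersOf_family_pos (n : ℕ) (c : ℝ) : ∀ x ∈ dom n c, ∀ y : V n, y ≠ 0 →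
    0 < randersOf (familyMetric c) (familyForm c) x y := fun x hx y hy => by
  rw [randersOf_family hx]; exact randers_pos hx hy

theorem randers_isFinsler (n : ℕ) (c : ℝ) : IsFinsler (dom n c) (randers c) :=
  ((isRiemannian_familyMetric n c).randersOf_isFinsler (isOpen_dom n c)
    (contDiffOn_familyForm n c) (randersOf_family_pos n c)).congr
    fun _ hx y => (randersOf_family hx y).symm

theorem berwaldFamily_isFinsler (n : ℕ) (c : ℝ) {η : ℝ} (hη : 0 < η) :
    IsFinsler (dom n c) (berwaldFamily c η) := by
  refine ((isRiemannian_familyMetric n c).deform_isFinsler (isOpen_dom n c)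
    (contDiffOn_familyForm n c) (randersOf_family_pos n c)
    (f := fun x => η / (1 - 4 * c ^ 2 * ‖x‖ ^ 2)) ?_ fun x hx => div_pos hη (dom_pos hx)).congr ?_
  · exact contDiffOn_const.div (contDiff_conformal n c).contDiffOn fun x hx => (dom_pos hx).ne'
  · intro x hx y
    unfold berwaldFamily deform
    rw [randersOf_family hx, riemNorm_familyMetric hx]

theorem hasFDerivAt_conformal (c : ℝ) (x : V n) :
    HasFDerivAt (fun x : V n => 1 - 4 * c ^ 2 * ‖x‖ ^ 2)
      (-((4 * c ^ 2 * 2) • euclidForm n x)) x := by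
  have h := ((hasFDerivAt_id x).norm_sq.const_mul (4 * c ^ 2)).const_sub 1
  refine h.congr_fderiv ?_
  ext v
  simp [euclidForm_apply]
  ring

theorem hasFDerivAt_inner_left (x y : V n) :
    HasFDerivAt (fun x' : V n => (inner ℝ x' y : ℝ)) (euclidForm n y) x := by
  refine (euclidForm n y).hasFDerivAt.congr_of_eventuallyEq (Eventually.of_forall fun z => ?_)
  exact real_inner_comm _ _

theorem hasFDerivAt_rad_base (hx : x ∈ dom n c) {y : V n} (hy : y ≠ 0) :
    HasFDerivAt (fun x' => rad c x' y)
      ((4 * c ^ 2 / rad c x y) • (inner ℝ x y • euclidForm n y - ‖y‖ ^ 2 • euclidForm n x)) x := by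
  have h1 := (hasFDerivAt_conformal c x).mul_const (‖y‖ ^ 2)
  have h2 := ((hasFDerivAt_inner_left x y).const_mul (2 * c)).pow 2
  have h3 := (h1.fun_add h2).sqrt (by
    rw [← radicand_eq]; exact ((sq_nonneg _).trans_lt (radicand_pos hx hy)).ne')
  simp only [← radicand_eq] at h3
  rw [show Real.sqrt (‖y‖ ^ 2 - 4 * c ^ 2 * (‖x‖ ^ 2 * ‖y‖ ^ 2 - inner ℝ x y ^ 2))
    = rad c x y from rfl] at h3
  refine h3.congr_fderiv ?_
  have := (rad_pos hx hy).ne'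
  ext v
  simp
  field_simp
  ring

theorem hasFDerivAt_rad_fib (hx : x ∈ dom n c) {y : V n} (hy : y ≠ 0) :
    HasFDerivAt (fun y' => rad c x y')
      ((rad c x y)⁻¹ • ((1 - 4 * c ^ 2 * ‖x‖ ^ 2) • euclidForm n y
        + (4 * c ^ 2 * inner ℝ x y) • euclidForm n x)) y := by
  have h1 := (hasFDerivAt_id y).norm_sq.const_mul (1 - 4 * c ^ 2 * ‖x‖ ^ 2)
  have h2 := (((euclidForm n x).hasFDerivAt (x := y)).const_mul (2 * c)).pow 2
  have h3 := (h1.fun_add h2).sqrt (by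
    simp only [id, euclidForm_apply]
    rw [← radicand_eq]; exact ((sq_nonneg _).trans_lt (radicand_pos hx hy)).ne')
  simp only [id, euclidForm_apply, ← radicand_eq] at h3
  rw [show Real.sqrt (‖y‖ ^ 2 - 4 * c ^ 2 * (‖x‖ ^ 2 * ‖y‖ ^ 2 - inner ℝ x y ^ 2))
    = rad c x y from rfl] at h3
  refine h3.congr_fderiv ?_
  have := (rad_pos hx hy).ne'
  ext v
  simp
  field_simp
  ring

theorem dFib_aPart (hx : x ∈ dom n c) {y : V n} (hy : y ≠ 0) (v : V n) :
    dFib (aPart c) x y v = ((1 - 4 * c ^ 2 * ‖x‖ ^ 2) * inner ℝ y v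
      + 4 * c ^ 2 * inner ℝ x y * inner ℝ x v)
        / (rad c x y * (1 - 4 * c ^ 2 * ‖x‖ ^ 2)) := by
  have h := (hasFDerivAt_rad_fib hx hy).mul_const (1 - 4 * c ^ 2 * ‖x‖ ^ 2)⁻¹
  simp only [← div_eq_mul_inv] at h
  unfold dFib
  erw [h.fderiv]
  have h1 := (rad_pos hx hy).ne'
  have h2 := (dom_pos hx).ne'
  simp
  field_simp

theorem dFib_bPart (x y v : V n) :
    dFib (bPart c) x y v = 2 * c * inner ℝ x v / (1 - 4 * c ^ 2 * ‖x‖ ^ 2) := by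
  have h := (((euclidForm n x).hasFDerivAt (x := y)).const_mul (2 * c)).mul_const
    (1 - 4 * c ^ 2 * ‖x‖ ^ 2)⁻¹
  simp only [← div_eq_mul_inv] at h
  unfold dFib
  erw [h.fderiv]
  simp
  ring

theorem dBase_bPart (hx : x ∈ dom n c) (y v : V n) :
    dBase (bPart c) x y v = 2 * c * inner ℝ y v / (1 - 4 * c ^ 2 * ‖x‖ ^ 2)
      + 2 * c * inner ℝ x y * (8 * c ^ 2 * inner ℝ x v) / (1 - 4 * c ^ 2 * ‖x‖ ^ 2) ^ 2 := by
  have h2 := (dom_pos hx).ne'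
  have h := ((hasFDerivAt_inner_left x y).const_mul (2 * c)).fun_mul
    ((hasFDerivAt_inv h2).comp x (hasFDerivAt_conformal c x))
  unfold dBase
  erw [h.fderiv]
  simp
  field_simp
  ring

/-- Since 4c²⟨x,v⟩/(1 − 4c²|x|²) = 2c d_J b(v), this reads ∂a/∂xⁱ = 2c ∂(ab)/∂yⁱ. Together with
∂b/∂xⁱ = c ∂(a² + b²)/∂yⁱ it sums to the equation for F. -/
theorem dBase_aPart (hx : x ∈ dom n c) {y : V n} (hy : y ≠ 0) (v : V n) :
    dBase (aPart c) x y v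
      = 4 * c ^ 2 * inner ℝ x v / (1 - 4 * c ^ 2 * ‖x‖ ^ 2) * aPart c x y
        + 2 * c * bPart c x y * dFib (aPart c) x y v := by
  have h1 := (rad_pos hx hy).ne'
  have h2 := (dom_pos hx).ne'
  have h := (hasFDerivAt_rad_base hx hy).fun_mul ((hasFDerivAt_inv h2).comp x (hasFDerivAt_conformal c x))
  have e : dBase (aPart c) x y v = 4 * c ^ 2 * (inner ℝ x y * inner ℝ y v
        - ‖y‖ ^ 2 * inner ℝ x v) / (rad c x y * (1 - 4 * c ^ 2 * ‖x‖ ^ 2))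
      + rad c x y * (8 * c ^ 2 * inner ℝ x v) / (1 - 4 * c ^ 2 * ‖x‖ ^ 2) ^ 2 := by
    unfold dBase
    erw [h.fderiv]
    simp
    field_simp
    ring
  rw [e, dFib_aPart hx hy]
  unfold aPart bPart
  -- After clearing denominators, the only relation needed between the scalars is the value of the
  -- squared radical.
  have hR := rad_mul_self hx hy
  generalize rad c x y = R at *
  generalize (inner ℝ x y : ℝ) = s at *
  generalize (inner ℝ x v : ℝ) = p at *
  generalize (inner ℝ y v : ℝ) = w at *
  generalize ‖x‖ ^ 2 = r at *
  generalize ‖y‖ ^ 2 = Y at *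
  field_simp
  linear_combination 4 * c ^ 2 * p * hR

theorem dBase_bPart' (hx : x ∈ dom n c) {y : V n} (hy : y ≠ 0) (v : V n) :
    dBase (bPart c) x y v
      = 2 * c * (aPart c x y * dFib (aPart c) x y v + bPart c x y * dFib (bPart c) x y v) := by
  have h1 := (rad_pos hx hy).ne'
  have h2 := (dom_pos hx).ne'
  rw [dBase_bPart hx, dFib_aPart hx hy, dFib_bPart]
  unfold aPart bPart
  field_simp
  ring

theorem contDiffAt_aPart (hx : x ∈ dom n c) {y : V n} (hy : y ≠ 0) :
    ContDiffAt ℝ ∞ (total (aPart c)) (x, y) := by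
  refine ((isRiemannian_familyMetric n c).isOneHomogeneous.contDiffAt (isOpen_dom n c)
    hx hy).congr_of_eventuallyEq ?_
  filter_upwards [slit_mem_nhds (isOpen_dom n c) hx hy] with q hq
  exact (riemNorm_familyMetric hq.1 q.2).symm

theorem contDiffAt_bPart (hx : x ∈ dom n c) (y : V n) :
    ContDiffAt ℝ ∞ (total (bPart c)) (x, y) := by
  have h := (contDiffOn_apply (contDiffOn_familyForm n c)).contDiffAt
    (((isOpen_dom n c).prod isOpen_univ).mem_nhds (show (x, y) ∈ _ from ⟨hx, trivial⟩))
  refine h.congr_of_eventuallyEq (Eventually.of_forall fun q => ?_)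
  exact (familyForm_apply q.1 q.2).symm

theorem dFib_add {A B : V n → V n → ℝ} {x y : V n}
    (hA : DifferentiableAt ℝ (total A) (x, y)) (hB : DifferentiableAt ℝ (total B) (x, y))
    (v : V n) :
    dFib (fun x' y' => A x' y' + B x' y') x y v = dFib A x y v + dFib B x y v := by
  rw [dFib_eq hA, dFib_eq hB, dFib_eq (hA.add hB)]
  exact congrArg (fun T => T (0, v)) (fderiv_fun_add hA hB)

theorem dBase_add {A B : V n → V n → ℝ} {x y : V n}
    (hA : DifferentiableAt ℝ (total A) (x, y)) (hB : DifferentiableAt ℝ (total B) (x, y))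
    (v : V n) :
    dBase (fun x' y' => A x' y' + B x' y') x y v = dBase A x y v + dBase B x y v := by
  rw [dBase_eq hA, dBase_eq hB, dBase_eq (hA.add hB)]
  exact congrArg (fun T => T (v, 0)) (fderiv_fun_add hA hB)

theorem dFib_randers (hx : x ∈ dom n c) {y : V n} (hy : y ≠ 0) (v : V n) :
    dFib (randers c) x y v = dFib (aPart c) x y v + dFib (bPart c) x y v :=
  dFib_add ((contDiffAt_aPart hx hy).differentiableAt (by simp))
    ((contDiffAt_bPart hx y).differentiableAt (by simp)) v

/-- The Randers metrics of the family satisfy `∂F/∂xⁱ = 2c F ∂F/∂yⁱ`. -/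
theorem dBase_randers (hx : x ∈ dom n c) {y : V n} (hy : y ≠ 0) (v : V n) :
    dBase (randers c) x y v = 2 * c * randers c x y * dFib (randers c) x y v := by
  have h : dBase (randers c) x y v = dBase (aPart c) x y v + dBase (bPart c) x y v :=
    dBase_add ((contDiffAt_aPart hx hy).differentiableAt (by simp))
      ((contDiffAt_bPart hx y).differentiableAt (by simp)) v
  rw [h, dFib_randers hx hy, dBase_aPart hx hy, dBase_bPart' hx hy, dFib_bPart]
  unfold randers
  ring

/-- The deformed metrics of the family satisfy `∂F̄/∂xⁱ = 2c ∂(F F̄)/∂yⁱ`. -/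
theorem dBase_berwaldFamily {η : ℝ} (hη : 0 < η) (hx : x ∈ dom n c) {y : V n} (hy : y ≠ 0)
    (v : V n) : dBase (berwaldFamily c η) x y v
      = 2 * c * (randers c x y * dFib (berwaldFamily c η) x y v
        + berwaldFamily c η x y * dFib (randers c) x y v) := by
  have hU := isOpen_dom n c
  have hL := (berwaldFamily_isFinsler n c hη).isOneHomogeneous.differentiableAt hU hx hy
  have hF := (randers_isFinsler n c).isOneHomogeneous.differentiableAt hU hx hy
  have ha := (contDiffAt_aPart hx hy).differentiableAt (by simp : (∞ : WithTop ℕ∞) ≠ 0)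
  have hD : DifferentiableAt ℝ (total fun x (_ : V n) => 1 - 4 * c ^ 2 * ‖x‖ ^ 2) (x, y) :=
    ((contDiff_conformal n c).comp contDiff_fst).differentiable (by simp) _
  have hfx := (hasFDerivAt_conformal c x).fderiv
  have hdD : dBase (fun x (_ : V n) => 1 - 4 * c ^ 2 * ‖x‖ ^ 2) x y v
      = -(8 * c ^ 2 * inner ℝ x v) := by
    unfold dBase; rw [hfx]
    simp only [neg_apply, smul_apply, euclidForm_apply, smul_eq_mul]; ring
  -- The definition without denominators, (1 − 4c²|x|²) F̄ a = ηF², is differentiated once in the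
  -- base and once in the fibre.
  have e : total (fun x' y' => (1 - 4 * c ^ 2 * ‖x'‖ ^ 2) * (berwaldFamily c η x' y' * aPart c x' y'))
      =ᶠ[𝓝 (x, y)] total (fun x' y' => η * (randers c x' y' * randers c x' y')) := by
    filter_upwards [slit_mem_nhds hU hx hy] with q hq
    have h1 := (dom_pos hq.1).ne'
    have h2 : aPart c q.1 q.2 ≠ 0 := (div_pos (rad_pos hq.1 hq.2) (dom_pos hq.1)).ne'
    simp only [total, berwaldFamily, deform]
    field_simp
  have hl := hD.mul (hL.mul ha)
  have hr := (hF.mul hF).const_mul η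
  have e1 : dBase (fun x' y' =>
        (1 - 4 * c ^ 2 * ‖x'‖ ^ 2) * (berwaldFamily c η x' y' * aPart c x' y')) x y v
      = dBase (fun x' y' => η * (randers c x' y' * randers c x' y')) x y v := by
    rw [dBase_eq hl, dBase_eq hr, e.fderiv_eq]
  have e2 : dFib (fun x' y' =>
        (1 - 4 * c ^ 2 * ‖x'‖ ^ 2) * (berwaldFamily c η x' y' * aPart c x' y')) x y v
      = dFib (fun x' y' => η * (randers c x' y' * randers c x' y')) x y v := by
    rw [dFib_eq hl, dFib_eq hr, e.fderiv_eq]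
  have e0 := e.self_of_nhds
  simp only [total] at e0
  rw [dBase_mul hD (hL.mul ha), dBase_mul hL ha, dBase_const_mul, dBase_mul hF hF, hdD,
    dBase_aPart hx hy, dBase_randers hx hy] at e1
  rw [dFib_mul hD (hL.mul ha), dFib_mul hL ha, dFib_const_mul, dFib_mul hF hF, dFib_base] at e2
  have h1 := (dom_pos hx).ne'
  have h2 : aPart c x y ≠ 0 := (div_pos (rad_pos hx hy) (dom_pos hx)).ne'
  have hb := dFib_bPart (c := c) x y v
  have hFb := dFib_randers hx hy v
  have hFF : randers c x y = aPart c x y + bPart c x y := rfl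
  have hp : 4 * c ^ 2 * inner ℝ x v / (1 - 4 * c ^ 2 * ‖x‖ ^ 2) = 2 * c * dFib (bPart c) x y v := by
    rw [hb]; ring
  have hp' : 8 * c ^ 2 * inner ℝ x v
      = (1 - 4 * c ^ 2 * ‖x‖ ^ 2) * (4 * c * dFib (bPart c) x y v) := by
    rw [hb]
    generalize 1 - 4 * c ^ 2 * ‖x‖ ^ 2 = D at h1 ⊢
    field_simp; ring
  rw [hp, hp'] at e1
  generalize dFib (bPart c) x y v = bv at *
  generalize dFib (aPart c) x y v = av at *
  generalize dFib (randers c) x y v = Fv at *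
  generalize dFib (berwaldFamily c η) x y v = Lv at *
  generalize dBase (berwaldFamily c η) x y v = Lx at *
  generalize berwaldFamily c η x y = L at *
  generalize randers c x y = F at *
  generalize aPart c x y = a at *
  generalize bPart c x y = b at *
  generalize 1 - 4 * c ^ 2 * ‖x‖ ^ 2 = D at *
  apply mul_left_cancel₀ (mul_ne_zero h1 h2)
  subst hFb hFF
  -- Subtracting 2cF times the fibre equation removes ηF² from the right side, because ∂F/∂xⁱ = 2cF
  -- ∂F/∂yⁱ.
  linear_combination e1 - 2 * c * (a + b) * e2

end Family

/-! ### Sprays, Hamel property and flatness of the family; Funk and Berwald metrics. -/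

section FamilySprays

variable {n : ℕ}

theorem berwaldFamily_eq (c η : ℝ) (x y : V n) : berwaldFamily c η x y =
    η * (rad c x y + 2 * c * inner ℝ x y) ^ 2 /
      ((1 - 4 * c ^ 2 * ‖x‖ ^ 2) ^ 2 * rad c x y) := by
  unfold berwaldFamily deform randers aPart bPart
  beta_reduce
  generalize 1 - 4 * c ^ 2 * ‖x‖ ^ 2 = D
  -- With the convention that division by zero is 0, both sides vanish in the degenerate cases, so
  -- no restriction on x and y is needed.
  rcases eq_or_ne D 0 with rfl | hD
  · simp
  rcases eq_or_ne (rad c x y) 0 with hR | hR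
  · simp [hR]
  field_simp

theorem randers_factor (n : ℕ) (c k : ℝ) :
    IsOneHomogeneous (dom n c) (fun x y => k * randers c x y) :=
  (randers_isFinsler n c).isOneHomogeneous.const_mul k

theorem randers_isGeodesicSpray (n : ℕ) (c : ℝ) :
    IsGeodesicSpray (dom n c) (randers c) (fun x y => (c * randers c x y) • y) :=
  (randers_isFinsler n c).isGeodesicSpray_smul (isOpen_dom n c) (randers_factor n c c)
    fun x hx y hy v => by rw [dBase_randers hx hy, dFib_const_mul]; ring

theorem berwaldFamily_isGeodesicSpray (n : ℕ) (c : ℝ) {η : ℝ} (hη : 0 < η) :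
    IsGeodesicSpray (dom n c) (berwaldFamily c η) (fun x y => (2 * c * randers c x y) • y) :=
  (berwaldFamily_isFinsler n c hη).isGeodesicSpray_smul (isOpen_dom n c)
    (randers_factor n c (2 * c))
    fun x hx y hy v => by rw [dBase_berwaldFamily hη hx hy, dFib_const_mul]; ring

theorem family_isProjectivelyRelatedBy (n : ℕ) (c : ℝ) {η : ℝ} (hη : 0 < η) :
    IsProjectivelyRelatedBy (dom n c) (randers c) (berwaldFamily c η)
      (fun x y => c * randers c x y) :=
  ⟨randers_isFinsler n c, berwaldFamily_isFinsler n c hη, randers_factor n c c, _, _,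
    randers_isGeodesicSpray n c, berwaldFamily_isGeodesicSpray n c hη,
    fun x _ y _ => by rw [← add_smul]; ring_nf⟩

/-- By projective invariance the flat spray may be used, and P = cF satisfies ∂P/∂xⁱ = ∂(P²)/∂yⁱ. -/
theorem randers_isHamel (n : ℕ) (c : ℝ) :
    IsHamel (dom n c) (fun x y => (c * randers c x y) • y) (fun x y => c * randers c x y) := by
  have hP := randers_factor n c c
  refine ⟨hP, fun x hx y hy v => ?_⟩
  rw [hP.eulerLagrange_projective (isOpen_dom n c) (G := fun _ _ => 0)
    (P := c * randers c x y) hx hy (zero_add _).symm]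
  refine eulerLagrange_zero_of_dBase (isOpen_dom n c) hP hP (fun x hx y hy v => ?_) hx hy v
  rw [dBase_const_mul, dBase_randers hx hy, dFib_const_mul]; ring

/-- The doubled factor P = 2cF satisfies ∂P/∂xⁱ = P ∂P/∂yⁱ, whereas cF satisfies the same equation
with an extra factor 2 on the right. -/
theorem berwaldFamily_hasConstantFlagCurvature (n : ℕ) (c : ℝ) {η : ℝ} (hη : 0 < η) :
    HasConstantFlagCurvature (dom n c) (berwaldFamily c η) 0 := by
  refine ⟨berwaldFamily_isFinsler n c hη, _, berwaldFamily_isGeodesicSpray n c hη,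
    fun x hx y hy v => ?_⟩
  rw [jacobi_smul_self (isOpen_dom n c) (randers_factor n c (2 * c)) (fun x hx y hy v => ?_)
    hx hy v]
  · simp
  · rw [dBase_const_mul, dBase_randers hx hy, dFib_const_mul]; ring

theorem dom_half (n : ℕ) : dom n (1 / 2) = Metric.ball 0 1 := by
  ext x
  rw [mem_ball_zero_iff, ← sq_lt_one_iff₀ (norm_nonneg x)]
  change 4 * (1 / 2 : ℝ) ^ 2 * ‖x‖ ^ 2 < 1 ↔ _
  norm_num

theorem four_mul_half_sq : 4 * (1 / 2 : ℝ) ^ 2 = 1 := by norm_num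

theorem randers_half : (randers (1 / 2) : V n → V n → ℝ) = funk := by
  funext x y
  unfold randers aPart bPart rad funk
  rw [four_mul_half_sq]
  norm_num

theorem berwaldFamily_half : (berwaldFamily (1 / 2) 1 : V n → V n → ℝ) = berwald := by
  funext x y
  rw [berwaldFamily_eq]
  unfold rad berwald
  rw [four_mul_half_sq]
  norm_num

end FamilySprays

end ProjFinsler

theorem mainTheorem11 (n : ℕ) :
    -- criterion for a Randers metric `F = a + b` (with `b` closed) and its deformation `f F² / a`
    (∀ (U : Set (V n)) (g : V n → V n →L[ℝ] V n →L[ℝ] ℝ) (β : V n → V n →L[ℝ] ℝ)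
        (f : V n → ℝ) (G : V n → V n → V n),
      IsOpen U → IsRiemannian U g → IsClosedForm U β → IsFinsler U (randersOf g β) →
      ContDiffOn ℝ ∞ f U → (∀ x ∈ U, 0 < f x) →
      IsGeodesicSpray U (randersOf g β) G →
      (IsProjectivelyRelated U (randersOf g β) (deform f (randersOf g β) (riemNorm g)) ↔
        ∀ x ∈ U, ∀ y : V n, y ≠ 0 → ∀ v : V n,
          randersOf g β x y ^ 2 / riemNorm g x y * horizDeriv G (fun x' _ => f x') x y v
            - sprayDeriv G (fun x' _ => f x') x y
                * dFib (fun x' y' => randersOf g β x' y' ^ 2 / riemNorm g x' y') x y v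
            + f x * sprayDeriv G (riemNorm g) x y
                * dFib (fun x' y' => randersOf g β x' y' ^ 2 / riemNorm g x' y' ^ 2) x y v
            = 0)) ∧
    -- the family of deformed metrics
    (∀ c η : ℝ, 0 < η →
      -- explicit form
      (∀ x ∈ dom n c, ∀ y : V n, berwaldFamily c η x y =
        η * (rad c x y + 2 * c * inner ℝ x y) ^ 2 /
          ((1 - 4 * c ^ 2 * ‖x‖ ^ 2) ^ 2 * rad c x y)) ∧
      -- both metrics are projectively flat Finsler metrics, with projective factors
      -- `c F` and `2 c F` relative to the flat spray
      IsProjectivelyFlat (dom n c) (randers c) ∧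
      IsGeodesicSpray (dom n c) (randers c) (fun x y => (c * randers c x y) • y) ∧
      IsProjectivelyFlat (dom n c) (berwaldFamily c η) ∧
      IsGeodesicSpray (dom n c) (berwaldFamily c η) (fun x y => (2 * c * randers c x y) • y) ∧
      -- they are projectively related, with factor `c F`, a Hamel function of the spray of `F`
      IsProjectivelyRelatedBy (dom n c) (randers c) (berwaldFamily c η)
        (fun x y => c * randers c x y) ∧
      IsHamel (dom n c) (fun x y => (c * randers c x y) • y) (fun x y => c * randers c x y) ∧
      -- the deformed metric has zero flag curvature
      HasConstantFlagCurvature (dom n c) (berwaldFamily c η) 0) ∧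
    -- the case `c = 1/2`, `η = 1`: the Funk and the Berwald metric of the unit ball
    (dom n (1 / 2) = Metric.ball 0 1 ∧
      (∀ x ∈ Metric.ball (0 : V n) 1, ∀ y : V n,
        randers (1 / 2) x y = funk x y ∧ berwaldFamily (1 / 2) 1 x y = berwald x y) ∧
      IsProjectivelyRelatedBy (Metric.ball (0 : V n) 1) funk berwald
        (fun x y => 1 / 2 * funk x y)) := by
  refine ⟨fun U g β f G hU hg hβ hF hf hf0 hG =>
      isProjectivelyRelated_deform_iff hU hg hβ hF hf hf0 hG,
    fun c η hη => ⟨fun x _ y => berwaldFamily_eq c η x y,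
      (randers_isFinsler n c).isProjectivelyFlat (randers_isGeodesicSpray n c),
      randers_isGeodesicSpray n c,
      (berwaldFamily_isFinsler n c hη).isProjectivelyFlat (berwaldFamily_isGeodesicSpray n c hη),
      berwaldFamily_isGeodesicSpray n c hη, family_isProjectivelyRelatedBy n c hη,
      randers_isHamel n c, berwaldFamily_hasConstantFlagCurvature n c hη⟩,
    dom_half n, fun x _ y => ⟨by rw [randers_half], by rw [berwaldFamily_half]⟩, ?_⟩
  have h := family_isProjectivelyRelatedBy n (1 / 2) one_pos
  rwa [randers_half, berwaldFamily_half, dom_half] at h
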